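/- **Setting.** Fix $d\ge 1$ and $n$. For every positive even integer $L$ let $\Lambda=\Lambda_L=(\mathbb Z/L\mathbb Z)^d$, where $\mathbb Z/L\mathbb Z$ is identified with $\{-L/2+1,\dots,L/2\}$, with its graph distance $\mathrm{dist}$; write $X^r=\{x\in\Lambda:\mathrm{dist}(x,X)\le r\}$. Consider on $\Lambda_L$ either a spin system, $\mathcal H=\bigotimes_{x\in\Lambda}\mathbb C^n$ with $\mathcal A_X$ the operators of the form $O_X\otimes 1$, or lattice fermions, $\mathcal H$ the antisymmetric Fock space over $\ell^2(\Lambda,\mathbb C^n)$ with $\mathcal A_X$ the algebra generated by the monomials with an even number of factors $c_{x,\sigma},c^*_{x,\sigma}$, $x\in X$; $\mathcal A=\mathcal A_\Lambda$. Let $$\Gamma=\{0\le x_1<\tfrac L2\},\quad \partial_-=\{x_1=0\},\quad \partial_+=\{x_1=\tfrac L2-1\},\quad S_-=\{|x_1|\le \tfrac L8\},\quad S_+=\{|x_1-\tfrac L2|\le\tfrac L8\},$$ where $x_1-\frac L2$ is taken modulo $L$. For a unit vector $\psi$ let $\mathrm{Var}_\psi(A)=\|(A-\langle\psi,A\psi\rangle)\psi\|^2$.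 For non-empty $X,X'\subset\Lambda$ let $d_1(X,X')$ be the minimal distance on the circle $\mathbb Z/L\mathbb Z$ between first coordinates of points of $X$ and of $X'$. Let $Q_x=Q_x^*\in\mathcal A_{\{x\}}$ have integer spectrum, let $Q=\sum_{x\in\Gamma}Q_x$, and assume $\|Q\|\le C|\Lambda|$ with $C$ independent of $L$. For each $L$ let $[-1,1]\ni s\mapsto U_s$ and $[-1,1]\ni s\mapsto\Omega_s$ be continuous families of unitaries in $\mathcal A$ and of unit vectors in $\mathcal H$ (the moduli of continuity may depend on $L$). $\mathcal O(L^{-\infty})$ means: bounded by a function of $L$ that decays faster than every power of $L$. Suppose that the following hold for every $s$, with all constants and all rates $\mathcal O(\cdot)$ independent of $s$ and of $L$: 1. if $A\in\mathcal A_X$ then for each $r\in\mathbb N$ there is $R_r\in\mathcal A_{X^r}$ with $\|U_s^*AU_s-R_r\|\le f(r)\,\|A\|\,|X|$, where $f(r)=\mathcal O(r^{-\infty})$ does not depend on $A,X$; 2. there are self-adjoint $T_\pm\in\mathcal A_{S_\pm}$ with $\|(U_s^*QU_s-Q)-T_--T_+\|=\mathcal O(L^{-\infty})$; 3. $\mathrm{Var}_{\Omega_s}(U_s)=\mathcal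 O(L^{-\infty})$; 4. there are self-adjoint $K_\pm\in\mathcal A_{\partial_\pm^{L/16}}$ with $\|K_\pm\|\le C|\Lambda|$ and $\mathrm{Var}_{\Omega_s}(Q-K_--K_+)=\mathcal O(L^{-\infty})$; 5. there are $0<c,C<\infty$ with $|\langle\Omega_s,AB\Omega_s\rangle-\langle\Omega_s,A\Omega_s\rangle\langle\Omega_s,B\Omega_s\rangle|\le C\|A\|\|B\||X||X'|e^{-c\,d_1(X,X')}$ for all $A\in\mathcal A_X$, $B\in\mathcal A_{X'}$. Call self-adjoint families $T_\pm(s)\in\mathcal A_{S_\pm}$ *admissible* if, uniformly in $s$, $$\|(U_s^*QU_s-Q)-T_-(s)-T_+(s)\|=\mathcal O(L^{-\infty}),\qquad e^{2\pi i(Q+T_-(s))}=1+\mathcal O(L^{-\infty}),\qquad \|T_\pm(s)\|\le C|\Lambda| .$$ **Proposition.** There is an admissible choice such that, for every $L$, $s\mapsto T_-(s)$ is continuous on $[-1,1]$. For every admissible choice with $s\mapsto T_-(s)$ continuous, $$\sup_{s\in[-1,1]}\bigl|\langle\Omega_s,T_-(s)\Omega_s\rangle-\langle\Omega_0,T_-(0)\Omega_0\rangle\bigr|=\mathcal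 O(L^{-\infty}),$$ and for all sufficiently large $L$ there is an integer $m=m(L)$ with $|\langle\Omega_s,T_-(s)\Omega_s\rangle-m|<\frac12$ for all $s\in[-1,1]$; that is, the integer closest to $\langle\Omega_s,T_-(s)\Omega_s\rangle$ is independent of $s$. -/

import Mathlib

open Filter Topology Set

noncomputable section

/-! ### The discrete torus -/

/-- Admissible side lengths of the torus: positive even integers. -/
abbrev EvenSide := {L : ℕ // 0 < L ∧ Even L}

instance (L : EvenSide) : NeZero (L : ℕ) := ⟨L.2.1.ne'⟩

/-- The discrete `d`-torus `(ℤ/Lℤ)^d`. The first coordinate of `x` is `x 0`; its representative in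
`{-L/2+1, …, L/2}` is `(x 0).valMinAbs`. -/
abbrev Site (d L : ℕ) := Fin d → ZMod L

namespace Site

/-- Distance of two points of the circle `ℤ/Lℤ`. -/
def circleDist {L : ℕ} (a b : ZMod L) : ℕ := (a - b).valMinAbs.natAbs

/-- Graph distance of the torus (nearest-neighbour graph). -/
def graphDist {d L : ℕ} (x y : Site d L) : ℕ := ∑ i, circleDist (x i) (y i)

/-- The fattening `X^r` of a region: all sites at graph distance at most `r` from `X`. -/
def fatten {d L : ℕ} [NeZero L] (X : Finset (Site d L)) (r : ℕ) : Finset (Site d L) :=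
  {x | ∃ y ∈ X, graphDist x y ≤ r}

/-- Distance of two regions in the first coordinate: the minimum of the circle distances of the
first coordinates (only relevant when both regions are non-empty). -/
def d1 {d L : ℕ} [NeZero d] (X X' : Finset (Site d L)) : ℕ :=
  sInf {m | ∃ x ∈ X, ∃ x' ∈ X', m = circleDist (x 0) (x' 0)}

variable (d L : ℕ) [NeZero d] [NeZero L]

/-- The half-torus `Γ = {0 ≤ x₁ < L/2}`. -/
def Gam : Finset (Site d L) := {x | 0 ≤ (x 0).valMinAbs ∧ 2 * (x 0).valMinAbs < L}

/-- `∂₋ = {x₁ = 0}`. -/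
def bdryMinus : Finset (Site d L) := {x | x 0 = 0}

/-- `∂₊ = {x₁ = L/2 - 1}`. -/
def bdryPlus : Finset (Site d L) := {x | x 0 = ((L / 2 : ℕ) : ZMod L) - 1}

/-- `S₋ = {-L/8 ≤ x₁ ≤ L/8}`. -/
def stripMinus : Finset (Site d L) := {x | 8 * circleDist (x 0) 0 ≤ L}

/-- `S₊ = {-L/8 ≤ x₁ - L/2 ≤ L/8}`, with `x₁ - L/2` taken modulo `L`. -/
def stripPlus : Finset (Site d L) := {x | 8 * circleDist (x 0) ((L / 2 : ℕ) : ZMod L) ≤ L}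

end Site

/-! ### Spin systems -/

/-- `A` is supported in `X` for a system of `n`-level spins on `Λ`: on `⨂_{x ∈ Λ} ℂⁿ`, with its
product basis labelled by `Λ → Fin n`, it has the form `O ⊗ 1` with `O` acting on `⨂_{x ∈ X} ℂⁿ`. -/
def spinLocal {Λ : Type} [Fintype Λ] [DecidableEq Λ] {n : ℕ} (X : Finset Λ) :
    Set (EuclideanSpace ℂ (Λ → Fin n) →L[ℂ] EuclideanSpace ℂ (Λ → Fin n)) :=
  {A | ∃ O : Matrix (X → Fin n) (X → Fin n) ℂ,
    A = Matrix.toEuclideanCLM (𝕜 := ℂ) (Matrix.of fun σ τ : Λ → Fin n =>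
      if ∀ x, x ∉ X → σ x = τ x then O (fun x => σ x) (fun x => τ x) else 0)}

/-! ### Fermions

The fermionic Fock space over `ℓ²(M)`, `M` the finite set of modes, has the occupation number basis
`e_S`, `S ⊆ M` (Slater determinants). Its signs refer to an enumeration of `M`. -/

/-- Annihilation operator of the mode `m`: `c_m e_S = (-1)^{#{k ∈ S : k < m}} e_{S \ m}` if `m ∈ S`,
and `c_m e_S = 0` otherwise. -/
def annihilation {M : Type} [Fintype M] [DecidableEq M] (m : M) :
    EuclideanSpace ℂ (Finset M) →L[ℂ] EuclideanSpace ℂ (Finset M) :=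
  Matrix.toEuclideanCLM (𝕜 := ℂ) (Matrix.of fun S' S : Finset M =>
    if m ∈ S ∧ S' = S.erase m then
      (-1) ^ (S.filter fun k => Fintype.equivFin M k < Fintype.equivFin M m).card else 0)

/-- The operators `c_{x,σ}` and `c*_{x,σ}` with `x ∈ X`. -/
def fermionGenerators {Λ : Type} [Fintype Λ] [DecidableEq Λ] {n : ℕ} (X : Finset Λ) :
    Set (EuclideanSpace ℂ (Finset (Λ × Fin n)) →L[ℂ] EuclideanSpace ℂ (Finset (Λ × Fin n))) :=
  {A | ∃ m : Λ × Fin n, m.1 ∈ X ∧ (A = annihilation m ∨ A = star (annihilation m))}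

/-- The even algebra of the region `X`: generated by all monomials with an even number of
creation and annihilation operators of sites of `X`. -/
def fermionLocal {Λ : Type} [Fintype Λ] [DecidableEq Λ] {n : ℕ} (X : Finset Λ) :
    Set (EuclideanSpace ℂ (Finset (Λ × Fin n)) →L[ℂ] EuclideanSpace ℂ (Finset (Λ × Fin n))) :=
  Algebra.adjoin ℂ {A | ∃ l : List (EuclideanSpace ℂ (Finset (Λ × Fin n)) →L[ℂ]
      EuclideanSpace ℂ (Finset (Λ × Fin n))),
    (∀ a ∈ l, a ∈ fermionGenerators X) ∧ Even l.length ∧ A = l.prod}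

/-! ### Lattice systems of either kind -/

/-- The two kinds of lattice systems. -/
inductive Statistics
  | spin
  | fermion

/-- Labels of the standard orthonormal basis of the Hilbert space. -/
def Conf : Statistics → ℕ → ℕ → ℕ → Type
  | .spin, d, n, L => Site d L → Fin n
  | .fermion, d, n, L => Finset (Site d L × Fin n)

instance Conf.fintype : (st : Statistics) → (d n L : ℕ) → [NeZero L] → Fintype (Conf st d n L)
  | .spin, d, n, L, _ => inferInstanceAs (Fintype (Site d L → Fin n))
  | .fermion, d, n, L, _ => inferInstanceAs (Fintype (Finset (Site d L × Fin n)))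

/-- The Hilbert space of the system on the torus of side `L`, with `n` levels (spins) or `n`
internal states (fermions) per site. -/
abbrev Hilb (st : Statistics) (d n L : ℕ) := EuclideanSpace ℂ (Conf st d n L)

/-- Operators on the Hilbert space, with the operator norm; `star` is the adjoint. -/
abbrev Op (st : Statistics) (d n L : ℕ) [NeZero L] := Hilb st d n L →L[ℂ] Hilb st d n L

/-- The algebra `𝒜_X` of observables supported in `X`. -/
def localAlg : (st : Statistics) → (d n L : ℕ) → [NeZero L] → Finset (Site d L) →
    Set (Op st d n L)
  | .spin, _, _, _, _, X => spinLocal X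
  | .fermion, _, _, _, _, X => fermionLocal X

/-! ### States -/

section States

variable {st : Statistics} {d n L : ℕ} [NeZero d] [NeZero L]

/-- `⟨ψ, A ψ⟩`. -/
def expVal (ψ : Hilb st d n L) (A : Op st d n L) : ℂ := inner ℂ ψ (A ψ)

/-- `Var_ψ(A) = ‖(A - ⟨ψ, A ψ⟩) ψ‖²`. -/
def stateVar (ψ : Hilb st d n L) (A : Op st d n L) : ℝ := ‖A ψ - expVal ψ A • ψ‖ ^ 2

/-- Clustering in the `x₁`-direction with given constants. -/
def IsClustering (C c : ℝ) (ψ : Hilb st d n L) : Prop :=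
  ∀ X X' : Finset (Site d L), ∀ A ∈ localAlg st d n L X, ∀ B ∈ localAlg st d n L X',
    ‖expVal ψ (A * B) - expVal ψ A * expVal ψ B‖ ≤
      C * ‖A‖ * ‖B‖ * X.card * X'.card * Real.exp (-c * Site.d1 X X')

/-- The charge `Q_Γ` of the half-torus. -/
def halfCharge (Q : Site d L → Op st d n L) : Op st d n L := ∑ x ∈ Site.Gam d L, Q x

end States

/-- `f(m) = O(m^{-∞})`. -/
abbrev RapidDecay (f : ℕ → ℝ) : Prop :=
  Asymptotics.SuperpolynomialDecay atTop (fun m : ℕ => (m : ℝ)) f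

/-! ### Families of models -/

section Families

variable {st : Statistics} {d n : ℕ} [NeZero d]

/-- Local charges: self-adjoint, on-site, with integer spectrum, and such that the charge of the
half-torus is of order at most the volume. -/
structure LocalCharges (Q : (L : EvenSide) → Site d L → Op st d n L) : Prop where
  selfAdjoint : ∀ (L : EvenSide) (x : Site d L), IsSelfAdjoint (Q L x)
  onSite : ∀ (L : EvenSide) (x : Site d L), Q L x ∈ localAlg st d n L {x}
  spectrum_int : ∀ (L : EvenSide) (x : Site d L),
    spectrum ℂ (Q L x) ⊆ Set.range ((↑) : ℤ → ℂ)
  norm_le : ∃ C : ℝ, ∀ L : EvenSide, ‖halfCharge (Q L)‖ ≤ C * (L : ℝ) ^ d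

/-- The assumptions on the unitaries `U_s` and the states `Ω_s`, `s ∈ [-1, 1]`: they hold for each
`s`, with rates and constants that depend neither on `s` nor on `L`. -/
structure UniformAssumptions (Q : (L : EvenSide) → Site d L → Op st d n L)
    (U : (L : EvenSide) → ℝ → Op st d n L) (Ω : (L : EvenSide) → ℝ → Hilb st d n L) : Prop where
  unitary_mem : ∀ L : EvenSide, ∀ s ∈ Icc (-1 : ℝ) 1,
    U L s ∈ unitary (Op st d n L) ∧ U L s ∈ localAlg st d n L Finset.univ
  norm_state : ∀ L : EvenSide, ∀ s ∈ Icc (-1 : ℝ) 1, ‖Ω L s‖ = 1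
  /-- `U_s` is an almost local unitary. -/
  almost_local : ∃ f : ℕ → ℝ, RapidDecay f ∧ ∀ L : EvenSide, ∀ s ∈ Icc (-1 : ℝ) 1,
    ∀ X : Finset (Site d L), ∀ A ∈ localAlg st d n L X, ∀ r : ℕ,
      ∃ R ∈ localAlg st d n L (Site.fatten X r),
        ‖star (U L s) * A * U L s - R‖ ≤ f r * (‖A‖ * X.card)
  /-- Local charge conservation. -/
  charge_conservation : ∃ f : ℕ → ℝ, RapidDecay f ∧ ∀ L : EvenSide, ∀ s ∈ Icc (-1 : ℝ) 1,
    ∃ Tm ∈ localAlg st d n L (Site.stripMinus d L), ∃ Tp ∈ localAlg st d n L (Site.stripPlus d L),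
      IsSelfAdjoint Tm ∧ IsSelfAdjoint Tp ∧
      ‖(star (U L s) * halfCharge (Q L) * U L s - halfCharge (Q L)) - Tm - Tp‖ ≤ f L
  /-- `Ω_s` is an approximate eigenvector of `U_s`. -/
  invariance : ∃ f : ℕ → ℝ, RapidDecay f ∧ ∀ L : EvenSide, ∀ s ∈ Icc (-1 : ℝ) 1,
    stateVar (Ω L s) (U L s) ≤ f L
  /-- Local charge fluctuations; `L / 16` is rounded down, which is immaterial because graph
  distances are integers. -/
  charge_fluctuations : ∃ (f : ℕ → ℝ) (C : ℝ), RapidDecay f ∧ ∀ L : EvenSide, ∀ s ∈ Icc (-1 : ℝ) 1,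
    ∃ Km ∈ localAlg st d n L (Site.fatten (Site.bdryMinus d L) ((L : ℕ) / 16)),
    ∃ Kp ∈ localAlg st d n L (Site.fatten (Site.bdryPlus d L) ((L : ℕ) / 16)),
      IsSelfAdjoint Km ∧ IsSelfAdjoint Kp ∧
      ‖Km‖ ≤ C * (L : ℝ) ^ d ∧ ‖Kp‖ ≤ C * (L : ℝ) ^ d ∧
      stateVar (Ω L s) (halfCharge (Q L) - Km - Kp) ≤ f L
  /-- Clustering in the `x₁`-direction. -/
  clustering : ∃ C c : ℝ, 0 < C ∧ 0 < c ∧ ∀ L : EvenSide, ∀ s ∈ Icc (-1 : ℝ) 1,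
    IsClustering C c (Ω L s)

/-- `T₋(s)`, `T₊(s)` are an admissible choice of transport operators: they are as in local charge
conservation, `exp(2πi(Q + T₋)) = 1 + O(L^{-∞})`, and `‖T_±‖ ≤ C |Λ|`, all uniformly in `s`. -/
structure AdmissibleTransport (Q : (L : EvenSide) → Site d L → Op st d n L)
    (U : (L : EvenSide) → ℝ → Op st d n L) (Tm Tp : (L : EvenSide) → ℝ → Op st d n L) :
    Prop where
  selfAdjoint : ∀ L : EvenSide, ∀ s ∈ Icc (-1 : ℝ) 1,
    IsSelfAdjoint (Tm L s) ∧ IsSelfAdjoint (Tp L s)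
  supported : ∀ L : EvenSide, ∀ s ∈ Icc (-1 : ℝ) 1,
    Tm L s ∈ localAlg st d n L (Site.stripMinus d L) ∧
    Tp L s ∈ localAlg st d n L (Site.stripPlus d L)
  splitting : ∃ f : ℕ → ℝ, RapidDecay f ∧ ∀ L : EvenSide, ∀ s ∈ Icc (-1 : ℝ) 1,
    ‖(star (U L s) * halfCharge (Q L) * U L s - halfCharge (Q L)) - Tm L s - Tp L s‖ ≤ f L
  integrality : ∃ f : ℕ → ℝ, RapidDecay f ∧ ∀ L : EvenSide, ∀ s ∈ Icc (-1 : ℝ) 1,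
    ‖NormedSpace.exp ((2 * Real.pi * Complex.I : ℂ) • (halfCharge (Q L) + Tm L s)) - 1‖ ≤ f L
  norm_le : ∃ C : ℝ, ∀ L : EvenSide, ∀ s ∈ Icc (-1 : ℝ) 1,
    ‖Tm L s‖ ≤ C * (L : ℝ) ^ d ∧ ‖Tp L s‖ ≤ C * (L : ℝ) ^ d

end Families

end

/-! The second half reduces to a pointwise statement: for each `s` the number `⟨Ω, T₋ Ω⟩` is within
`O(L^{-∞})` of an integer. A continuous function on an interval whose values stay close to integers
stays close to a single one.

Pointwise statement. Clustering makes the two strips almost independent. Put `R = Q - K₋ - K₊`,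
which has `Ω` as approximate eigenvector with value `q`, and let `K±'` be strip-supported
approximations of `U* K± U`. The dressed operators `T± - K±' + K±` add up to almost `U* R U - R`,
which nearly annihilates `Ω`. Being almost uncorrelated, each of them has `Ω` as approximate
eigenvector (`dressed_dispersion`). Let `τ` be the expectation of the left one, `T`; as `U` nearly
fixes `Ω` up to a phase, `τ ≈ ⟨Ω, T₋ Ω⟩` (`abs_dressed_sub_le`).

Because the on-site charges are integers, `exp(2πi(Q + K))` is supported where `K` is, and it is
multiplicative over disjoint supports (`chargeExp_add`). With `Z = exp(2πi(Q - K₋))` and `Z' =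
exp(2πi(Q - K₊))`, the product `Z Z' = exp(2πiR)` acts on `Ω` almost as `exp(2πiq)`. Again by
clustering `Ω` is nearly an eigenvector of both factors, with values `z`, `z'` and `z z' ≈
exp(2πiq)`. Since `exp(2πi(Q + T₊)) ≈ 1`, the unitary `W = exp(2πi(Q + T₋ - K₋'))` is close to `U* Z
U`, so `W Z' Ω ≈ z z' Ω`. But `W Z' = exp(2πi(R + T))` multiplies `Ω` by almost `exp(2πi(q + τ))`.
Hence `exp(2πiτ) ≈ 1` (`norm_exp_expectation_sub_one_le`).

Existence. The bounded splittings `(A, B)` of `U* Q U - Q` within a given tolerance form a convex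
set, and one splitting serves all nearby parameters at a small loss, so a partition of unity yields
a continuous choice. The unitaries `exp(2πi(Q + A))` and `exp(2πi(Q + B))` are nearly inverse to
each other and live on disjoint strips, so the first is nearly scalar
(`localStarAlg_exists_norm_sub_le`). Moving the largest spectral value of `Q + A` from `A` to `B`
makes this scalar nearly 1; it depends continuously on `A`, so continuity survives
(`exists_continuousOn_transport`). -/

noncomputable section

/-! ### Matrix elements and anticommutation relations of fermion operators -/

namespace FermiMat
open Matrix
variable {M : Type} [Fintype M]

/-- The Jordan-Wigner sign of the mode `m` in the configuration `S`. -/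
def jwSign (m : M) (S : Finset M) : ℂ :=
  (-1) ^ (S.filter fun k => Fintype.equivFin M k < Fintype.equivFin M m).card

theorem jwSign_ne_zero (m : M) (S : Finset M) : jwSign m S ≠ 0 := by
  simp [jwSign]

theorem conj_jwSign (m : M) (S : Finset M) : (starRingEnd ℂ) (jwSign m S) = jwSign m S := by
  simp [jwSign]

variable [DecidableEq M]

/-- The matrix of the annihilation operator. -/
def ann (m : M) : Matrix (Finset M) (Finset M) ℂ :=
  Matrix.of fun S' S => if m ∈ S ∧ S' = S.erase m then jwSign m S else 0

theorem jwSign_insert (m k : M) {S : Finset M} (hk : k ∉ S) :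
    jwSign m (insert k S) =
      (if Fintype.equivFin M k < Fintype.equivFin M m then -1 else 1) * jwSign m S := by
  unfold jwSign
  rw [Finset.filter_insert]
  split_ifs with h
  · rw [Finset.card_insert_of_notMem (by simp [hk]), pow_succ]; ring
  · simp

theorem jwSign_insert_self (m : M) (S : Finset M) : jwSign m (insert m S) = jwSign m S := by
  by_cases h : m ∈ S
  · rw [Finset.insert_eq_of_mem h]
  · simp [jwSign_insert m m h]

theorem mul_ann (A : Matrix (Finset M) (Finset M) ℂ) (k : M) (S' S : Finset M) :
    (A * ann k) S' S = if k ∈ S then A S' (S.erase k) * jwSign k S else 0 := by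
  rw [Matrix.mul_apply, Finset.sum_eq_single (S.erase k)]
  · simp [ann]
  · intro R _ hR
    simp [ann, hR]
  · simp

theorem ann_mul (A : Matrix (Finset M) (Finset M) ℂ) (k : M) (S' S : Finset M) :
    (ann k * A) S' S = if k ∉ S' then jwSign k S' * A (insert k S') S else 0 := by
  rw [Matrix.mul_apply, Finset.sum_eq_single (insert k S')]
  · by_cases h : k ∈ S'
    · have : S' ≠ S'.erase k := fun h' => by rw [h'] at h; simp at h
      simp [ann, h, this]
    · simp [ann, h, jwSign_insert_self]
  · intro R _ hR
    have : ¬ (k ∈ R ∧ S' = R.erase k) := by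
      rintro ⟨h1, rfl⟩; exact hR (Finset.insert_erase h1).symm
    simp [ann, this]
  · simp

theorem mul_star_ann (A : Matrix (Finset M) (Finset M) ℂ) (k : M) (S' S : Finset M) :
    (A * star (ann k)) S' S = if k ∉ S then A S' (insert k S) * jwSign k S else 0 := by
  have h : A * star (ann k) = star (ann k * star A) := by simp
  rw [h, Matrix.star_apply, ann_mul]
  split_ifs <;> simp [conj_jwSign, mul_comm]

theorem star_ann_mul (A : Matrix (Finset M) (Finset M) ℂ) (k : M) (S' S : Finset M) :
    (star (ann k) * A) S' S = if k ∈ S' then jwSign k S' * A (S'.erase k) S else 0 := by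
  have h : star (ann k) * A = star (star A * ann k) := by simp
  rw [h, Matrix.star_apply, mul_ann]
  split_ifs <;> simp [conj_jwSign, mul_comm]

/-- Only columns containing both modes matter. There, in exactly one of the two orders of removal,
the mode earlier in the enumeration is still occupied when the later one is removed; this produces
the relative sign. -/
theorem ann_mul_ann {m k : M} (h : m ≠ k) : ann m * ann k = -(ann k * ann m) := by
  ext S' S
  rw [Matrix.neg_apply, mul_ann, mul_ann]
  by_cases hk : k ∈ S
  swap
  · simp [hk, ann]
  by_cases hm : m ∈ S
  swap
  · simp [hm, ann]
  obtain ⟨R, rfl, hmR, hkR⟩ : ∃ R, S = insert m (insert k R) ∧ m ∉ R ∧ k ∉ R :=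
    ⟨(S.erase m).erase k, by ext; simp; grind, by simp, by simp⟩
  have e1 : (insert m (insert k R)).erase k = insert m R := by ext; simp; grind
  have e2 : (insert m (insert k R)).erase m = insert k R := by ext; simp; grind
  have e3 : (insert m R).erase m = R := by ext; simp; grind
  have e4 : (insert k R).erase k = R := by ext; simp; grind
  have hlt : Fintype.equivFin M m ≠ Fintype.equivFin M k := fun h' => h (by simpa using h')
  simp only [ann, Matrix.of_apply, e1, e2, e3, e4, Finset.mem_insert, true_or, or_true, if_true,
    true_and]
  split_ifs with hS
  · rw [jwSign_insert_self, jwSign_insert_self, jwSign_insert_self, jwSign_insert k m (by simp; grind),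
      jwSign_insert_self, jwSign_insert m k hkR]
    rcases lt_or_gt_of_ne hlt with h1 | h1
    · simp [h1, h1.not_gt, mul_comm]
    · simp [h1, h1.not_gt, mul_comm]
  · simp

theorem ann_mul_star_ann {m k : M} (h : m ≠ k) :
    ann m * star (ann k) = -(star (ann k) * ann m) := by
  ext S' S
  rw [Matrix.neg_apply, mul_star_ann, mul_ann]
  have hlt : Fintype.equivFin M m ≠ Fintype.equivFin M k := fun h' => h (by simpa using h')
  have hs : ∀ R : Finset M, star (ann k) S' R =
      if k ∉ R ∧ S' = insert k R then jwSign k R else 0 := by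
    intro R
    have := mul_star_ann (1 : Matrix (Finset M) (Finset M) ℂ) k S' R
    rw [one_mul] at this
    rw [this, Matrix.one_apply]
    split_ifs <;> simp_all
  rw [hs]
  by_cases hm : m ∈ S
  swap
  · simp [hm, ann, h]
  by_cases hk : k ∈ S
  · simp [hk, h.symm]
  obtain ⟨R, rfl, hmR⟩ : ∃ R, S = insert m R ∧ m ∉ R :=
    ⟨S.erase m, by ext; simp; grind, by simp⟩
  have hkR : k ∉ R := fun h => hk (by simp [h])
  have e1 : (insert k (insert m R)).erase m = insert k R := by ext; simp; grind
  have e2 : (insert m R).erase m = R := by ext; simp; grind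
  simp only [ann, Matrix.of_apply, e1, e2, hk, hkR, not_false_eq_true, if_true, true_and,
    Finset.mem_insert, true_or, or_true]
  split_ifs with hS
  · rw [Finset.insert_comm, jwSign_insert_self, jwSign_insert_self, jwSign_insert k m hmR,
      jwSign_insert m k hkR]
    rcases lt_or_gt_of_ne hlt with h1 | h1
    · simp [h1, h1.not_gt, mul_comm]
    · simp [h1, h1.not_gt, mul_comm]
  · simp

/-- If the occupations of `m` differ, one side of a commutation relation, at a suitable entry,
vanishes because the mode is already filled or already empty, while the other is `± A S T`. -/
theorem apply_eq_zero_of_commute {A : Matrix (Finset M) (Finset M) ℂ} {m : M}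
    (h1 : Commute A (ann m)) (h2 : Commute A (star (ann m))) {S T : Finset M}
    (h : ¬ (m ∈ S ↔ m ∈ T)) : A S T = 0 := by
  by_cases hS : m ∈ S
  · have hT : m ∉ T := by tauto
    have := congrFun₂ h1.eq S (insert m T)
    rw [mul_ann, ann_mul] at this
    simpa [hS, hT, jwSign_ne_zero] using this
  · have hT : m ∈ T := by tauto
    have := congrFun₂ h2.eq S (T.erase m)
    rw [mul_star_ann, star_ann_mul] at this
    simpa [hS, hT, jwSign_ne_zero] using this

/-- Lets a mode be added to, or removed from, both indices of a matrix element at the price of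
nonzero signs. -/
theorem apply_insert_of_commute {A : Matrix (Finset M) (Finset M) ℂ} {m : M}
    (h1 : Commute A (ann m)) {S T : Finset M} (hS : m ∉ S) (hT : m ∉ T) :
    A S T * jwSign m T = jwSign m S * A (insert m S) (insert m T) := by
  have := congrFun₂ h1.eq S (insert m T)
  rw [mul_ann, ann_mul] at this
  simpa [hS, hT, jwSign_insert_self] using this

end FermiMat

/-- Distance to the scalars, from a compression that is faithful on the subalgebra. -/
theorem norm_sub_algebraMap_le_of_compression {H : Type} [NormedAddCommGroup H]
    [InnerProductSpace ℂ H] [FiniteDimensional ℂ H] (S : StarSubalgebra ℂ (H →L[ℂ] H))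
    {P A B : H →L[ℂ] H} {l : ℂ} (hP : IsStarProjection P)
    (hS : ∀ A ∈ S, Commute A P) (hinj : ∀ A ∈ S, A * P = 0 → A = 0) (hA : A ∈ S)
    (hB : P * B * P = l • P) : ‖A - algebraMap ℂ _ l‖ ≤ ‖A - B‖ := by
  have : CompleteSpace H := FiniteDimensional.complete ℂ H
  have hcl : IsClosed (S : Set (H →L[ℂ] H)) :=
    Submodule.closed_of_finiteDimensional (Subalgebra.toSubmodule S.toSubalgebra)
  let _ : CStarAlgebra S := StarSubalgebra.cstarAlgebra S (h_closed := hcl)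
  -- Commutation with `P` makes `A ↦ A P` multiplicative, and an injective star-homomorphism of
  -- C⋆-algebras is isometric. So compressing an element of `S` loses no norm, whereas it turns `B`
  -- into a scalar.
  let φ : S →⋆ₙₐ[ℂ] (H →L[ℂ] H) :=
    { toFun := fun A => A.1 * P
      map_smul' := fun c A => by simp
      map_zero' := by simp
      map_add' := fun A B => by simp [add_mul]
      map_mul' := fun A B => by
        have := (hS B.1 B.2).eq
        calc (A.1 * B.1) * P = A.1 * (B.1 * P) * P := by
              rw [mul_assoc, mul_assoc, mul_assoc, hP.isIdempotentElem.eq]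
          _ = _ := by rw [this]; simp only [mul_assoc]; rw [this]
      map_star' := fun A => by
        have := (hS _ (star_mem A.2)).eq
        simp only [StarMemClass.coe_star, star_mul, hP.isSelfAdjoint.star_eq, this] }
  have hφ : Function.Injective φ := by
    rw [injective_iff_map_eq_zero]
    intro A h
    exact Subtype.ext (hinj A.1 A.2 h)
  have hmem : A - algebraMap ℂ _ l ∈ S := sub_mem hA (S.algebraMap_mem l)
  have h1 := NonUnitalStarAlgHom.norm_map φ hφ ⟨_, hmem⟩
  have h2 : φ ⟨_, hmem⟩ = P * (A - B) * P := by
    change (A - algebraMap ℂ _ l) * P = _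
    rw [mul_sub, sub_mul, sub_mul (P * A), hB, ← (hS A hA).eq, mul_assoc, hP.isIdempotentElem.eq,
      Algebra.algebraMap_eq_smul_one, smul_mul_assoc, one_mul]
  have hP1 : ‖P‖ ≤ 1 := IsStarProjection.norm_le P hP
  calc ‖A - algebraMap ℂ _ l‖ = ‖φ ⟨_, hmem⟩‖ := h1.symm
    _ ≤ ‖P‖ * ‖A - B‖ * ‖P‖ := by
      rw [h2]; exact (norm_mul_le _ _).trans (by gcongr; exact norm_mul_le _ _)
    _ ≤ 1 * ‖A - B‖ * 1 := by gcongr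
    _ = _ := by ring

/-! ### Local algebras of spin systems -/

namespace SpinLocal
variable {Λ : Type} [Fintype Λ] [DecidableEq Λ] {n : ℕ}

/-- The matrix of `O ⊗ 1`. -/
def mat (X : Finset Λ) (O : Matrix (X → Fin n) (X → Fin n) ℂ) :
    Matrix (Λ → Fin n) (Λ → Fin n) ℂ :=
  Matrix.of fun σ τ => if ∀ x, x ∉ X → σ x = τ x then O (fun x => σ x) (fun x => τ x) else 0

/-- The configuration equal to `a` on `X` and to `σ` elsewhere. -/
def glue {X : Finset Λ} (a : X → Fin n) (σ : Λ → Fin n) : Λ → Fin n :=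
  fun x => if h : x ∈ X then a ⟨x, h⟩ else σ x

omit [Fintype Λ] in
theorem glue_restrict {X : Finset Λ} (a : X → Fin n) (σ : Λ → Fin n) :
    (fun x : X => glue a σ x) = a := by
  ext x; simp [glue]

omit [Fintype Λ] in
theorem glue_of_notMem {X : Finset Λ} (a : X → Fin n) (σ : Λ → Fin n) {x : Λ} (hx : x ∉ X) :
    glue a σ x = σ x := by
  simp [glue, hx]

theorem mat_one (X : Finset Λ) : mat X (1 : Matrix (X → Fin n) (X → Fin n) ℂ) = 1 := by
  ext σ τ
  simp only [mat, Matrix.of_apply, Matrix.one_apply]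
  by_cases h : σ = τ
  · simp [h]
  · rw [if_neg h]
    split_ifs with h1 h2
    · exact absurd (funext fun x => if hx : x ∈ X then congrFun h2 ⟨x, hx⟩ else h1 x hx) h
    · rfl
    · rfl

theorem mat_smul (X : Finset Λ) (c : ℂ) (O : Matrix (X → Fin n) (X → Fin n) ℂ) :
    mat X (c • O) = c • mat X O := by
  ext σ τ; simp [mat]

theorem mat_add (X : Finset Λ) (O O' : Matrix (X → Fin n) (X → Fin n) ℂ) :
    mat X (O + O') = mat X O + mat X O' := by
  ext σ τ; simp only [mat, Matrix.of_apply, Matrix.add_apply]; split_ifs <;> simp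

theorem mat_star (X : Finset Λ) (O : Matrix (X → Fin n) (X → Fin n) ℂ) :
    mat X (star O) = star (mat X O) := by
  ext σ τ
  simp only [mat, Matrix.of_apply, Matrix.star_apply, eq_comm (a := σ _)]
  split_ifs <;> simp

theorem mat_mul (X : Finset Λ) (O O' : Matrix (X → Fin n) (X → Fin n) ℂ) :
    mat X (O * O') = mat X O * mat X O' := by
  ext σ τ
  rw [Matrix.mul_apply]
  by_cases h : ∀ x, x ∉ X → σ x = τ x
  · simp only [mat, Matrix.of_apply, if_pos h, Matrix.mul_apply]
    refine Fintype.sum_of_injective (fun a : X → Fin n => glue a σ) ?_ _ _ ?_ ?_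
    · intro a b hab
      rw [← glue_restrict a σ, ← glue_restrict b σ]
      simp only at hab
      rw [hab]
    · intro ρ hρ
      rw [if_neg, zero_mul]
      intro h1
      refine hρ ⟨fun x => ρ x, funext fun x => ?_⟩
      by_cases hx : x ∈ X
      · simp [glue, hx]
      · simp [glue, hx, h1 x hx]
    · intro a
      rw [if_pos (fun x hx => (glue_of_notMem a σ hx).symm),
        if_pos (fun x hx => by rw [glue_of_notMem a σ hx, h x hx]), glue_restrict]
  · simp only [mat, Matrix.of_apply, if_neg h]
    refine (Finset.sum_eq_zero fun ρ _ => ?_).symm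
    by_cases h1 : ∀ x, x ∉ X → σ x = ρ x
    · rw [if_neg (c := ∀ x, x ∉ X → ρ x = τ x), mul_zero]
      exact fun h2 => h fun x hx => (h1 x hx).trans (h2 x hx)
    · rw [if_neg h1, zero_mul]

/-- Only one intermediate configuration contributes: the one already changed to `τ` on `X` and still
equal to `σ` elsewhere. -/
theorem mat_mul_mat_of_disjoint {X Y : Finset Λ} (hXY : Disjoint X Y)
    (O : Matrix (X → Fin n) (X → Fin n) ℂ) (O' : Matrix (Y → Fin n) (Y → Fin n) ℂ)
    (σ τ : Λ → Fin n) :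
    (mat X O * mat Y O') σ τ = if ∀ x, x ∉ X → x ∉ Y → σ x = τ x then
      O (fun x => σ x) (fun x => τ x) * O' (fun x => σ x) (fun x => τ x) else 0 := by
  have hd : ∀ x, x ∈ Y → x ∉ X := fun x hY hX => Finset.disjoint_left.1 hXY hX hY
  rw [Matrix.mul_apply, Finset.sum_eq_single (fun x => if x ∈ X then τ x else σ x)]
  · have h1 : ∀ x, x ∉ X → σ x = if x ∈ X then τ x else σ x := fun x hx => by simp [hx]
    have h2 : (∀ x, x ∉ Y → (if x ∈ X then τ x else σ x) = τ x) ↔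
        ∀ x, x ∉ X → x ∉ Y → σ x = τ x :=
      ⟨fun h x hX hY => by simpa [hX] using h x hY, fun h x hY => by
        by_cases hX : x ∈ X
        · simp [hX]
        · simpa [hX] using h x hX hY⟩
    have h3 : (fun x : X => if (x : Λ) ∈ X then τ x else σ x) = fun x : X => τ x := by
      ext x; simp
    have h4 : (fun x : Y => if (x : Λ) ∈ X then τ x else σ x) = fun x : Y => σ x := by
      ext x; simp [hd x x.2]
    simp only [mat, Matrix.of_apply, h2, h3, h4]
    rw [if_pos h1]
    split_ifs <;> simp
  · intro ρ _ hρ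
    simp only [mat, Matrix.of_apply]
    by_cases h1 : ∀ x, x ∉ X → σ x = ρ x
    · by_cases h2 : ∀ x, x ∉ Y → ρ x = τ x
      · refine absurd (funext fun x => ?_) hρ
        by_cases hx : x ∈ X
        · simp [hx, h2 x (fun hY => hd x hY hx)]
        · simp [hx, h1 x hx]
      · rw [if_neg h2, mul_zero]
    · rw [if_neg h1, zero_mul]
  · simp

theorem commute_mat {X Y : Finset Λ} (hXY : Disjoint X Y)
    (O : Matrix (X → Fin n) (X → Fin n) ℂ) (O' : Matrix (Y → Fin n) (Y → Fin n) ℂ) :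
    Commute (mat X O) (mat Y O') := by
  ext σ τ
  rw [mat_mul_mat_of_disjoint hXY, mat_mul_mat_of_disjoint hXY.symm, mul_comm]
  have : (∀ x, x ∉ X → x ∉ Y → σ x = τ x) ↔ ∀ x, x ∉ Y → x ∉ X → σ x = τ x :=
    forall_congr' fun x => by tauto
  simp only [this]

theorem exists_mat_eq_of_subset {X Y : Finset Λ} (hXY : X ⊆ Y)
    (O : Matrix (X → Fin n) (X → Fin n) ℂ) : ∃ O', mat X O = mat Y O' := by
  refine ⟨Matrix.of fun σ τ => if ∀ x : Y, (x : Λ) ∉ X → σ x = τ x then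
    O (fun x => σ ⟨x, hXY x.2⟩) (fun x => τ ⟨x, hXY x.2⟩) else 0, ?_⟩
  ext σ τ
  simp only [mat, Matrix.of_apply]
  by_cases h : ∀ x, x ∉ X → σ x = τ x
  · rw [if_pos h, if_pos (fun x hx => h x fun h' => hx (hXY h')), if_pos (fun (x : Y) hx => h x hx)]
  · rw [if_neg h]
    split_ifs with h1 h2
    · refine absurd (fun x hx => ?_) h
      by_cases hY : x ∈ Y
      · exact h2 ⟨x, hY⟩ hx
      · exact h1 x hY
    · rfl
    · rfl

/-- The spin observables of a region as a star-subalgebra. -/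
def starAlg (n : ℕ) (X : Finset Λ) :
    StarSubalgebra ℂ (EuclideanSpace ℂ (Λ → Fin n) →L[ℂ] EuclideanSpace ℂ (Λ → Fin n)) where
  carrier := spinLocal X
  mul_mem' := by
    rintro _ _ ⟨O, rfl⟩ ⟨O', rfl⟩
    exact ⟨O * O', by rw [← map_mul]; exact congrArg _ (mat_mul X O O').symm⟩
  one_mem' := ⟨1, (map_one (Matrix.toEuclideanCLM (𝕜 := ℂ) (n := Λ → Fin n))).symm.trans
    (congrArg _ (mat_one X).symm)⟩
  add_mem' := by
    rintro _ _ ⟨O, rfl⟩ ⟨O', rfl⟩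
    exact ⟨O + O', by rw [← map_add]; exact congrArg _ (mat_add X O O').symm⟩
  zero_mem' := ⟨0, (map_zero (Matrix.toEuclideanCLM (𝕜 := ℂ) (n := Λ → Fin n))).symm.trans
    (congrArg _ (by ext; simp))⟩
  algebraMap_mem' := fun c => ⟨c • 1, by
    rw [Algebra.algebraMap_eq_smul_one,
      ← map_one (Matrix.toEuclideanCLM (𝕜 := ℂ) (n := Λ → Fin n)), ← map_smul, ← mat_one X]
    exact congrArg _ (mat_smul X c 1).symm⟩
  star_mem' := by
    rintro _ ⟨O, rfl⟩
    exact ⟨star O, by rw [← map_star]; exact congrArg _ (mat_star X O).symm⟩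

theorem mem_starAlg {X : Finset Λ}
    {A : EuclideanSpace ℂ (Λ → Fin n) →L[ℂ] EuclideanSpace ℂ (Λ → Fin n)} :
    A ∈ starAlg n X ↔ ∃ O, A = Matrix.toEuclideanCLM (𝕜 := ℂ) (mat X O) :=
  Iff.rfl

theorem starAlg_mono {X Y : Finset Λ} (h : X ⊆ Y) : starAlg n X ≤ starAlg n Y := by
  intro A hA
  obtain ⟨O, rfl⟩ := mem_starAlg.1 hA
  obtain ⟨O', h'⟩ := exists_mat_eq_of_subset h O
  exact mem_starAlg.2 ⟨O', congrArg _ h'⟩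

theorem commute_of_disjoint {X Y : Finset Λ} (hXY : Disjoint X Y)
    {A B : EuclideanSpace ℂ (Λ → Fin n) →L[ℂ] EuclideanSpace ℂ (Λ → Fin n)}
    (hA : A ∈ starAlg n X) (hB : B ∈ starAlg n Y) : Commute A B := by
  obtain ⟨O, rfl⟩ := mem_starAlg.1 hA
  obtain ⟨O', rfl⟩ := mem_starAlg.1 hB
  exact (commute_mat hXY O O').map (Matrix.toEuclideanCLM (𝕜 := ℂ) (n := Λ → Fin n))

/-- Freezing the spins outside `X` to a reference configuration `η` is faithful on observables of
`X`, while an observable of `Y` is reduced to its diagonal element at `η`. -/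
theorem exists_norm_sub_le {X Y : Finset Λ} (hXY : Disjoint X Y)
    {A B : EuclideanSpace ℂ (Λ → Fin n) →L[ℂ] EuclideanSpace ℂ (Λ → Fin n)}
    (hA : A ∈ starAlg n X) (hB : B ∈ starAlg n Y) :
    ∃ l : ℂ, ‖A - algebraMap ℂ _ l‖ ≤ ‖A - B‖ := by
  rcases isEmpty_or_nonempty (Λ → Fin n) with hemp | ⟨⟨η⟩⟩
  · refine ⟨0, ?_⟩
    rw [Subsingleton.elim (A - algebraMap ℂ _ 0) (A - B)]
  obtain ⟨O', rfl⟩ := mem_starAlg.1 hB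
  set p : (Λ → Fin n) → ℂ := fun σ => if ∀ x, x ∉ X → σ x = η x then 1 else 0 with hp
  have hd : ∀ x, x ∈ Y → x ∉ X := fun x hY hX => Finset.disjoint_left.1 hXY hX hY
  refine ⟨O' (fun x => η x) (fun x => η x), norm_sub_algebraMap_le_of_compression (starAlg n X)
    (P := Matrix.toEuclideanCLM (𝕜 := ℂ) (Matrix.diagonal p)) ⟨?_, ?_⟩ ?_ ?_ hA ?_⟩
  · rw [IsIdempotentElem, ← map_mul, Matrix.diagonal_mul_diagonal]
    congr 2; ext σ; simp [hp]
  · rw [IsSelfAdjoint, ← map_star, Matrix.star_eq_conjTranspose, Matrix.diagonal_conjTranspose]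
    congr 2; ext σ; simp only [hp, Pi.star_apply]; split_ifs <;> simp
  · intro A hA
    obtain ⟨O, rfl⟩ := mem_starAlg.1 hA
    refine Commute.map (f := Matrix.toEuclideanCLM (𝕜 := ℂ) (n := Λ → Fin n)) ?_
    ext σ τ
    rw [Matrix.mul_diagonal, Matrix.diagonal_mul, mat, Matrix.of_apply]
    split_ifs with h
    · have : p σ = p τ := by
        simp only [hp]
        congr 1
        exact propext (forall₂_congr fun x hx => by rw [h x hx])
      rw [this, mul_comm]
    · simp
  · intro A hA h0
    obtain ⟨O, rfl⟩ := mem_starAlg.1 hA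
    rw [← map_mul, ← map_zero (Matrix.toEuclideanCLM (𝕜 := ℂ) (n := Λ → Fin n))] at h0
    have h1 := (Matrix.toEuclideanCLM (𝕜 := ℂ) (n := Λ → Fin n)).injective h0
    have : O = 0 := by
      ext a b
      have h2 := congrFun₂ h1 (glue a η) (glue b η)
      rw [Matrix.mul_diagonal, mat, Matrix.of_apply, if_pos (fun x hx => by
        rw [glue_of_notMem a η hx, glue_of_notMem b η hx]), glue_restrict, glue_restrict] at h2
      have h3 : p (glue b η) = 1 := if_pos fun x hx => glue_of_notMem b η hx
      simpa [h3] using h2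
    rw [this, ← map_zero (Matrix.toEuclideanCLM (𝕜 := ℂ) (n := Λ → Fin n))]
    congr 1; ext; simp [mat]
  · rw [← map_mul, ← map_mul, ← map_smul]
    congr 1
    ext σ τ
    rw [Matrix.mul_diagonal, Matrix.diagonal_mul, Matrix.smul_apply, Matrix.diagonal_apply,
      mat, Matrix.of_apply]
    by_cases hσ : ∀ x, x ∉ X → σ x = η x
    swap
    · simp [hp, hσ]
    by_cases hτ : ∀ x, x ∉ X → τ x = η x
    swap
    · have : σ ≠ τ := fun h => hτ (h ▸ hσ)
      simp [hp, hτ, this]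
    have hpσ : p σ = 1 := if_pos hσ
    have hpτ : p τ = 1 := if_pos hτ
    have e1 : (fun x : Y => σ x) = fun x : Y => η x := funext fun x => hσ x (hd x x.2)
    have e2 : (fun x : Y => τ x) = fun x : Y => η x := funext fun x => hτ x (hd x x.2)
    rw [hpσ, hpτ, e1, e2]
    by_cases h : σ = τ
    · simp [h]
    · rw [if_neg, if_neg h]
      · simp
      · intro h'
        refine h (funext fun x => ?_)
        by_cases hx : x ∈ X
        · exact h' x fun hY => hd x hY hx
        · rw [hσ x hx, hτ x hx]

end SpinLocal

/-! ### Even local algebras of lattice fermions -/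

namespace FermionLocal
open FermiMat
variable {Λ : Type} [Fintype Λ] [DecidableEq Λ] {n : ℕ}

theorem annihilation_eq {M : Type} [Fintype M] [DecidableEq M] (m : M) :
    annihilation m = Matrix.toEuclideanCLM (𝕜 := ℂ) (ann m) := rfl

theorem star_annihilation_eq {M : Type} [Fintype M] [DecidableEq M] (m : M) :
    star (annihilation m) = Matrix.toEuclideanCLM (𝕜 := ℂ) (star (ann m)) := by
  rw [annihilation_eq, map_star]

theorem star_ann_mul_ann {M : Type} [Fintype M] [DecidableEq M] {m k : M} (h : m ≠ k) :
    star (ann m) * ann k = -(ann k * star (ann m)) := by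
  rw [ann_mul_star_ann h.symm, neg_neg]

theorem star_ann_mul_star_ann {M : Type} [Fintype M] [DecidableEq M] {m k : M} (h : m ≠ k) :
    star (ann m) * star (ann k) = -(star (ann k) * star (ann m)) := by
  rw [← star_mul, ann_mul_ann h.symm, star_neg, star_mul]

theorem generators_anticommute {X Y : Finset Λ} (hXY : Disjoint X Y)
    {a b : EuclideanSpace ℂ (Finset (Λ × Fin n)) →L[ℂ] EuclideanSpace ℂ (Finset (Λ × Fin n))}
    (ha : a ∈ fermionGenerators X) (hb : b ∈ fermionGenerators Y) : a * b = -(b * a) := by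
  obtain ⟨m, hm, ha⟩ := ha
  obtain ⟨k, hk, hb⟩ := hb
  have hmk : m ≠ k := fun h => Finset.disjoint_left.1 hXY hm (h ▸ hk)
  rcases ha with rfl | rfl <;> rcases hb with rfl | rfl <;>
    simp only [annihilation_eq, ← map_star, ← map_mul, ← map_neg]
  · rw [ann_mul_ann hmk]
  · rw [ann_mul_star_ann hmk]
  · rw [star_ann_mul_ann hmk]
  · rw [star_ann_mul_star_ann hmk]

theorem list_prod_mul_of_anticommute {R : Type*} [Ring R] {b : R} (l : List R)
    (h : ∀ a ∈ l, a * b = -(b * a)) : l.prod * b = (-1) ^ l.length * (b * l.prod) := by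
  induction l with
  | nil => simp
  | cons a l ih =>
    have h1 := ih fun x hx => h x (List.mem_cons_of_mem _ hx)
    have h2 := h a List.mem_cons_self
    rw [List.prod_cons, List.length_cons, mul_assoc, h1, ← mul_assoc,
      ((Commute.neg_one_right a).pow_right _).eq, mul_assoc, ← mul_assoc a, h2]
    simp [pow_succ, mul_assoc]

theorem commute_list_prod_of_even {R : Type*} [Ring R] {b : R} (l : List R)
    (h : ∀ a ∈ l, a * b = -(b * a)) (he : Even l.length) : l.prod * b = b * l.prod := by
  rw [list_prod_mul_of_anticommute l h, he.neg_one_pow, one_mul]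

/-- Moving an odd generator through an even monomial of another region yields an even number of
signs. Hence even observables commute with odd ones as well, a fact the matrix-element arguments
need. -/
theorem commute_generator {X Y : Finset Λ} (hXY : Disjoint X Y)
    {A b : EuclideanSpace ℂ (Finset (Λ × Fin n)) →L[ℂ] EuclideanSpace ℂ (Finset (Λ × Fin n))}
    (hA : A ∈ fermionLocal X) (hb : b ∈ fermionGenerators Y) : Commute A b := by
  have : A ∈ Subalgebra.centralizer ℂ {b} := by
    refine Algebra.adjoin_le ?_ hA
    rintro _ ⟨l, hl, he, rfl⟩
    rw [SetLike.mem_coe, Subalgebra.mem_centralizer_iff]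
    rintro _ rfl
    exact (commute_list_prod_of_even l (fun a ha => generators_anticommute hXY (hl a ha) hb)
      he).symm
  exact ((Subalgebra.mem_centralizer_iff ℂ).1 this b rfl).symm

theorem commute_of_disjoint {X Y : Finset Λ} (hXY : Disjoint X Y)
    {A B : EuclideanSpace ℂ (Finset (Λ × Fin n)) →L[ℂ] EuclideanSpace ℂ (Finset (Λ × Fin n))}
    (hA : A ∈ fermionLocal X) (hB : B ∈ fermionLocal Y) : Commute A B := by
  have : B ∈ Subalgebra.centralizer ℂ {A} := by
    refine Algebra.adjoin_le ?_ hB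
    rintro _ ⟨l, hl, -, rfl⟩
    rw [SetLike.mem_coe, Subalgebra.mem_centralizer_iff]
    rintro _ rfl
    exact Commute.list_prod_right _ _ fun b hb => commute_generator hXY hA (hl b hb)
  exact (Subalgebra.mem_centralizer_iff ℂ).1 this A rfl

theorem star_mem_generators {X : Finset Λ}
    {a : EuclideanSpace ℂ (Finset (Λ × Fin n)) →L[ℂ] EuclideanSpace ℂ (Finset (Λ × Fin n))}
    (ha : a ∈ fermionGenerators X) : star a ∈ fermionGenerators X := by
  obtain ⟨m, hm, rfl | rfl⟩ := ha
  · exact ⟨m, hm, Or.inr rfl⟩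
  · exact ⟨m, hm, Or.inl (star_star _)⟩

theorem star_list_prod {R : Type*} [Monoid R] [StarMul R] (l : List R) :
    star l.prod = (l.map star).reverse.prod := by
  induction l with
  | nil => simp
  | cons a l ih => simp [ih]

/-- The even fermion observables of a region as a star-subalgebra. -/
def starAlg (n : ℕ) (X : Finset Λ) : StarSubalgebra ℂ
    (EuclideanSpace ℂ (Finset (Λ × Fin n)) →L[ℂ] EuclideanSpace ℂ (Finset (Λ × Fin n))) where
  toSubalgebra := Algebra.adjoin ℂ {A | ∃ l : List (EuclideanSpace ℂ (Finset (Λ × Fin n)) →L[ℂ]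
      EuclideanSpace ℂ (Finset (Λ × Fin n))),
    (∀ a ∈ l, a ∈ fermionGenerators X) ∧ Even l.length ∧ A = l.prod}
  star_mem' := by
    intro A hA
    have h := Subalgebra.star_adjoin_comm ℂ {A | ∃ l : List (EuclideanSpace ℂ
      (Finset (Λ × Fin n)) →L[ℂ] EuclideanSpace ℂ (Finset (Λ × Fin n))),
      (∀ a ∈ l, a ∈ fermionGenerators X) ∧ Even l.length ∧ A = l.prod}
    have h1 : star A ∈ star (Algebra.adjoin ℂ {A | ∃ l : List (EuclideanSpace ℂ
      (Finset (Λ × Fin n)) →L[ℂ] EuclideanSpace ℂ (Finset (Λ × Fin n))),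
      (∀ a ∈ l, a ∈ fermionGenerators X) ∧ Even l.length ∧ A = l.prod}) := by
      rw [Subalgebra.mem_star_iff, star_star]; exact hA
    rw [h] at h1
    refine Algebra.adjoin_mono ?_ h1
    intro B hB
    obtain ⟨l, hl, he, hB⟩ := hB
    refine ⟨(l.map star).reverse, ?_, by simpa using he, ?_⟩
    · intro a ha
      simp only [List.mem_reverse, List.mem_map] at ha
      obtain ⟨b, hb, rfl⟩ := ha
      exact star_mem_generators (hl b hb)
    · rw [← star_list_prod, ← hB, star_star]

theorem mem_starAlg {X : Finset Λ}
    {A : EuclideanSpace ℂ (Finset (Λ × Fin n)) →L[ℂ] EuclideanSpace ℂ (Finset (Λ × Fin n))} :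
    A ∈ starAlg n X ↔ A ∈ fermionLocal X :=
  Iff.rfl

theorem starAlg_mono {X Y : Finset Λ} (h : X ⊆ Y) : starAlg n X ≤ starAlg n Y := by
  intro A hA
  refine Algebra.adjoin_mono ?_ (mem_starAlg.1 hA)
  rintro B ⟨l, hl, he, hB⟩
  refine ⟨l, fun a ha => ?_, he, hB⟩
  obtain ⟨m, hm, h'⟩ := hl a ha
  exact ⟨m, h hm, h'⟩

theorem commute_ann {X : Finset Λ} {m : Λ × Fin n} (hm : m.1 ∉ X)
    {A : Matrix (Finset (Λ × Fin n)) (Finset (Λ × Fin n)) ℂ}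
    (hA : Matrix.toEuclideanCLM (𝕜 := ℂ) A ∈ fermionLocal X) :
    Commute A (ann m) ∧ Commute A (star (ann m)) := by
  have hd : Disjoint X {m.1} := by simpa using hm
  have inj := (Matrix.toEuclideanCLM (𝕜 := ℂ) (n := Finset (Λ × Fin n))).injective
  constructor
  · have := commute_generator hd hA (b := annihilation m) ⟨m, by simp, Or.inl rfl⟩
    refine inj ?_
    rw [map_mul, map_mul]
    exact this.eq
  · have := commute_generator hd hA (b := star (annihilation m)) ⟨m, by simp, Or.inr rfl⟩
    rw [star_annihilation_eq] at this
    refine inj ?_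
    rw [map_mul, map_mul]
    exact this.eq

/-- The compression is to configurations with no particle outside `X`. An observable of `Y` commutes
with all creation and annihilation operators in `X`, which act irreducibly there, so it compresses
to its vacuum expectation. -/
theorem exists_norm_sub_le {X Y : Finset Λ} (hXY : Disjoint X Y)
    {A B : EuclideanSpace ℂ (Finset (Λ × Fin n)) →L[ℂ] EuclideanSpace ℂ (Finset (Λ × Fin n))}
    (hA : A ∈ starAlg n X) (hB : B ∈ starAlg n Y) :
    ∃ l : ℂ, ‖A - algebraMap ℂ _ l‖ ≤ ‖A - B‖ := by
  have surj : Function.Surjective (Matrix.toEuclideanCLM (𝕜 := ℂ) (n := Finset (Λ × Fin n))) :=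
    EquivLike.surjective _
  have inj : Function.Injective (Matrix.toEuclideanCLM (𝕜 := ℂ) (n := Finset (Λ × Fin n))) :=
    EquivLike.injective _
  obtain ⟨B, rfl⟩ := surj B
  set p : Finset (Λ × Fin n) → ℂ := fun S => if ∀ m ∈ S, m.1 ∈ X then 1 else 0 with hp
  refine ⟨B ∅ ∅, norm_sub_algebraMap_le_of_compression (starAlg n X)
    (P := Matrix.toEuclideanCLM (𝕜 := ℂ) (Matrix.diagonal p)) ⟨?_, ?_⟩ ?_ ?_ hA ?_⟩
  · rw [IsIdempotentElem, ← map_mul, Matrix.diagonal_mul_diagonal]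
    congr 2; ext S; simp [hp]
  · rw [IsSelfAdjoint, ← map_star, Matrix.star_eq_conjTranspose, Matrix.diagonal_conjTranspose]
    congr 2; ext S; simp only [hp, Pi.star_apply]; split_ifs <;> simp
  · intro A hA
    obtain ⟨A, rfl⟩ := surj A
    refine Commute.map (f := Matrix.toEuclideanCLM (𝕜 := ℂ) (n := Finset (Λ × Fin n))) ?_
    ext S T
    rw [Matrix.mul_diagonal, Matrix.diagonal_mul]
    by_cases h : ∀ m : Λ × Fin n, m.1 ∉ X → (m ∈ S ↔ m ∈ T)
    · have : p S = p T := by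
        simp only [hp]
        congr 1
        refine propext ⟨fun h1 m hm => ?_, fun h1 m hm => ?_⟩
        · by_contra h2
          exact h2 (h1 m ((h m h2).2 hm))
        · by_contra h2
          exact h2 (h1 m ((h m h2).1 hm))
      rw [this, mul_comm]
    · push Not at h
      obtain ⟨m, hm, h⟩ := h
      have hc := commute_ann hm (mem_starAlg.1 hA)
      rw [apply_eq_zero_of_commute hc.1 hc.2 (by tauto)]
      simp
  · intro A hA h0
    obtain ⟨A, rfl⟩ := surj A
    rw [← map_mul, ← map_zero (Matrix.toEuclideanCLM (𝕜 := ℂ) (n := Finset (Λ × Fin n)))] at h0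
    have h1 := inj h0
    -- Faithfulness: modes outside `X` are stripped from both indices until the column `T` lies in
    -- the range of `P`, where `A P = 0` applies.
    have key : ∀ T S : Finset (Λ × Fin n), A S T = 0 := by
      intro T
      induction T using Finset.strongInduction with
      | H T ih =>
        intro S
        by_cases hT : ∀ m ∈ T, m.1 ∈ X
        · have h2 := congrFun₂ h1 S T
          rw [Matrix.mul_diagonal] at h2
          have h3 : p T = 1 := if_pos hT
          simpa [h3] using h2
        · push Not at hT
          obtain ⟨m, hm, hmX⟩ := hT
          have hc := commute_ann hmX (mem_starAlg.1 hA)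
          by_cases hS : m ∈ S
          · have h4 := apply_insert_of_commute hc.1 (Finset.notMem_erase m S)
              (Finset.notMem_erase m T)
            rw [ih _ (Finset.erase_ssubset hm), Finset.insert_erase hS, Finset.insert_erase hm,
              zero_mul] at h4
            exact (mul_eq_zero.1 h4.symm).resolve_left (jwSign_ne_zero _ _)
          · exact apply_eq_zero_of_commute hc.1 hc.2 (by tauto)
    have : A = 0 := by ext S T; exact key T S
    rw [this, map_zero]
  · rw [← map_mul, ← map_mul, ← map_smul]
    congr 1
    have hc : ∀ m : Λ × Fin n, m.1 ∈ X → Commute B (ann m) ∧ Commute B (star (ann m)) :=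
      fun m hm => commute_ann (Finset.disjoint_left.1 hXY hm) (mem_starAlg.1 hB)
    -- Filling modes of `X` one at a time does not change the diagonal entry: the same sign occurs
    -- on both sides and cancels.
    have hdiag : ∀ S : Finset (Λ × Fin n), (∀ m ∈ S, m.1 ∈ X) → B S S = B ∅ ∅ := by
      intro S
      induction S using Finset.induction_on with
      | empty => intro _; rfl
      | insert m S hm ih =>
        intro h
        rw [← ih fun k hk => h k (Finset.mem_insert_of_mem hk)]
        have h4 := apply_insert_of_commute (hc m (h m (Finset.mem_insert_self _ _))).1 hm hm
        rw [mul_comm] at h4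
        exact (mul_left_cancel₀ (jwSign_ne_zero _ _) h4).symm
    ext S T
    rw [Matrix.mul_diagonal, Matrix.diagonal_mul, Matrix.smul_apply, Matrix.diagonal_apply]
    by_cases hS : ∀ m ∈ S, m.1 ∈ X
    swap
    · have h0 : p S = 0 := if_neg hS
      simp [h0]
    by_cases hT : ∀ m ∈ T, m.1 ∈ X
    swap
    · have : S ≠ T := fun h => hT (h ▸ hS)
      have h0 : p T = 0 := if_neg hT
      simp [h0, this]
    have hpS : p S = 1 := if_pos hS
    have hpT : p T = 1 := if_pos hT
    rw [hpS, hpT]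
    by_cases h : S = T
    · subst h
      simp [hdiag S hS]
    · have : ∃ m : Λ × Fin n, ¬ (m ∈ S ↔ m ∈ T) := by
        by_contra! h'
        exact h (Finset.ext h')
      obtain ⟨m, hm⟩ := this
      have hmX : m.1 ∈ X := by
        by_cases hmS : m ∈ S
        · exact hS m hmS
        · exact hT m (by tauto)
      rw [apply_eq_zero_of_commute (hc m hmX).1 (hc m hmX).2 hm]
      simp [h]

end FermionLocal

/-! ### Locality properties common to spins and fermions -/

section LocalAlgebra

variable {st : Statistics} {d n L : ℕ} [NeZero L]

/-- The local algebra as a star-subalgebra. -/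
def localStarAlg : (st : Statistics) → (d n L : ℕ) → [NeZero L] → Finset (Site d L) →
    StarSubalgebra ℂ (Op st d n L)
  | .spin, _, n, _, _, X => SpinLocal.starAlg n X
  | .fermion, _, n, _, _, X => FermionLocal.starAlg n X

theorem mem_localStarAlg {X : Finset (Site d L)} {A : Op st d n L} :
    A ∈ localStarAlg st d n L X ↔ A ∈ localAlg st d n L X := by
  cases st <;> rfl

theorem localStarAlg_mono {X Y : Finset (Site d L)} (h : X ⊆ Y) :
    localStarAlg st d n L X ≤ localStarAlg st d n L Y := by
  cases st
  · exact SpinLocal.starAlg_mono h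
  · exact FermionLocal.starAlg_mono h

theorem localStarAlg_commute {X Y : Finset (Site d L)} (h : Disjoint X Y) {A B : Op st d n L}
    (hA : A ∈ localStarAlg st d n L X) (hB : B ∈ localStarAlg st d n L Y) : Commute A B := by
  cases st
  · exact SpinLocal.commute_of_disjoint h hA hB
  · exact FermionLocal.commute_of_disjoint h hA hB

theorem localStarAlg_exists_norm_sub_le {X Y : Finset (Site d L)} (h : Disjoint X Y)
    {A B : Op st d n L} (hA : A ∈ localStarAlg st d n L X) (hB : B ∈ localStarAlg st d n L Y) :
    ∃ l : ℂ, ‖A - algebraMap ℂ _ l‖ ≤ ‖A - B‖ := by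
  cases st
  · exact SpinLocal.exists_norm_sub_le h hA hB
  · exact FermionLocal.exists_norm_sub_le h hA hB

theorem localStarAlg_isClosed (X : Finset (Site d L)) :
    IsClosed (localStarAlg st d n L X : Set (Op st d n L)) :=
  Submodule.closed_of_finiteDimensional
    (Subalgebra.toSubmodule (localStarAlg st d n L X).toSubalgebra)

end LocalAlgebra

/-! ### The exponential `exp(2πiA)` -/

section ExpTwoPi

variable {H : Type*} [NormedAddCommGroup H] [InnerProductSpace ℂ H] [CompleteSpace H]

theorem exp_mem_unitary_of_skew {a : H →L[ℂ] H} (ha : a ∈ skewAdjoint (H →L[ℂ] H)) :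
    NormedSpace.exp a ∈ unitary (H →L[ℂ] H) := by
  let _ : NormedAlgebra ℚ (H →L[ℂ] H) := NormedAlgebra.restrictScalars ℚ ℂ _
  exact NormedSpace.exp_mem_unitary_of_mem_skewAdjoint ha

theorem star_exp_op (a : H →L[ℂ] H) : star (NormedSpace.exp a) = NormedSpace.exp (star a) := by
  let _ : NormedAlgebra ℚ (H →L[ℂ] H) := NormedAlgebra.restrictScalars ℚ ℂ _
  exact NormedSpace.star_exp a

open NormedSpace in
/-- Duhamel estimate for exponentials of skew-adjoint operators on a vector. -/
theorem norm_exp_sub_exp_apply_le {a b : H →L[ℂ] H} (ha : a ∈ skewAdjoint (H →L[ℂ] H))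
    {x : H} {C : ℝ} (h : ∀ t : ℝ, ‖(b - a) (exp (t • b) x)‖ ≤ C) :
    ‖exp b x - exp a x‖ ≤ C := by
  have hu : ∀ t : ℝ, exp (t • a) ∈ unitary (H →L[ℂ] H) := fun t =>
    exp_mem_unitary_of_skew (skewAdjoint.smul_mem t ha)
  have hstar : ∀ t : ℝ, star (exp (t • a)) = exp (t • -a) := fun t => by
    rw [star_exp_op, star_smul, skewAdjoint.mem_iff.1 ha]; rfl
  have hn : ∀ (V : H →L[ℂ] H), V ∈ unitary (H →L[ℂ] H) → ∀ y, ‖V y‖ = ‖y‖ := fun V hV y =>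
    Unitary.norm_map ⟨V, hV⟩ y
  let Φ : (H →L[ℂ] H) →L[ℝ] H := (ContinuousLinearMap.apply ℂ H x).restrictScalars ℝ
  have hd : ∀ t : ℝ, HasDerivAt (fun t : ℝ => exp (t • -a) * exp (t • b))
      (exp (t • -a) * -a * exp (t • b) + exp (t • -a) * (b * exp (t • b))) t := fun t =>
    (hasDerivAt_exp_smul_const (𝕂 := ℝ) (-a) t).mul (hasDerivAt_exp_smul_const' (𝕂 := ℝ) b t)
  have hd' : ∀ t : ℝ, HasDerivAt (fun t : ℝ => Φ (exp (t • -a) * exp (t • b)))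
      (Φ (exp (t • -a) * -a * exp (t • b) + exp (t • -a) * (b * exp (t • b)))) t := fun t =>
    Φ.hasFDerivAt.comp_hasDerivAt t (hd t)
  -- The derivative of `exp(-ta) exp(tb) x` is `exp(-ta) (b - a) exp(tb) x`, and the unitary
  -- `exp(-ta)` does not change its norm.
  have key := norm_image_sub_le_of_norm_deriv_le_segment_01' (C := C)
    (fun t _ => (hd' t).hasDerivWithinAt) (fun t _ => by
      have e : Φ (exp (t • -a) * -a * exp (t • b) + exp (t • -a) * (b * exp (t • b))) =
          (star (exp (t • a))) ((b - a) (exp (t • b) x)) := by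
        rw [hstar]
        simp [Φ, sub_eq_neg_add]
      rw [e, hn _ (Unitary.star_mem (hu t))]
      exact h t)
  have e1 : exp b x - exp a x =
      exp a (Φ (exp ((1 : ℝ) • -a) * exp ((1 : ℝ) • b)) - Φ (exp ((0 : ℝ) • -a) * exp ((0 : ℝ) • b))) := by
    have h1 : exp a * star (exp a) = 1 := by
      have := Unitary.mul_star_self_of_mem (hu 1)
      rwa [one_smul] at this
    have h2 := hstar 1
    rw [one_smul] at h2
    rw [← h2, map_sub]
    simp only [Φ, zero_smul, exp_zero, one_smul]
    change _ = exp a (star (exp a) (exp b x)) - exp a x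
    rw [← mul_apply_eq_comp, h1]
    rfl
  rw [e1, hn]
  · exact key
  · have := hu 1
    rwa [one_smul] at this

/-- `exp (2πi A)`. -/
def expTwoPi {A : Type*} [NormedRing A] [NormedAlgebra ℂ A] (a : A) : A :=
  NormedSpace.exp ((2 * Real.pi * Complex.I : ℂ) • a)

theorem smul_mem_skewAdjoint_of_isSelfAdjoint {A : H →L[ℂ] H} (hA : IsSelfAdjoint A) (t : ℝ) :
    t • (2 * Real.pi * Complex.I : ℂ) • A ∈ skewAdjoint (H →L[ℂ] H) := by
  rw [skewAdjoint.mem_iff, star_smul, star_smul, hA.star_eq]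
  simp

theorem expTwoPi_mem_unitary {A : H →L[ℂ] H} (hA : IsSelfAdjoint A) :
    expTwoPi A ∈ unitary (H →L[ℂ] H) := by
  have := smul_mem_skewAdjoint_of_isSelfAdjoint hA 1
  rw [one_smul] at this
  exact exp_mem_unitary_of_skew this

theorem norm_expTwoPi_sub_le {A B : H →L[ℂ] H} (hA : IsSelfAdjoint A) (hB : IsSelfAdjoint B) :
    ‖expTwoPi B - expTwoPi A‖ ≤ 2 * Real.pi * ‖B - A‖ := by
  refine ContinuousLinearMap.opNorm_le_bound _ (by positivity) fun x => ?_
  refine norm_exp_sub_exp_apply_le (a := (2 * Real.pi * Complex.I : ℂ) • A)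
    (b := (2 * Real.pi * Complex.I : ℂ) • B)
    (by simpa using smul_mem_skewAdjoint_of_isSelfAdjoint hA 1) fun t => ?_
  have hu := exp_mem_unitary_of_skew
    (smul_mem_skewAdjoint_of_isSelfAdjoint hB t)
  refine (ContinuousLinearMap.le_opNorm _ _).trans ?_
  rw [Unitary.norm_map ⟨_, hu⟩ x, ← smul_sub, norm_smul]
  gcongr
  simp [abs_of_pos Real.pi_pos]

/-- Duhamel is run along the scalar flow of `q`, which moves `x` only by a phase; so only the defect
of `x` as an eigenvector enters, and not `‖A‖`. -/
theorem norm_expTwoPi_apply_sub_le {A : H →L[ℂ] H} (hA : IsSelfAdjoint A) (q : ℝ) (x : H) :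
    ‖expTwoPi A x - Complex.exp (2 * Real.pi * Complex.I * q) • x‖ ≤
      2 * Real.pi * ‖A x - (q : ℂ) • x‖ := by
  have hs : ∀ z : ℂ, NormedSpace.exp (z • (1 : H →L[ℂ] H)) = Complex.exp z • 1 := fun z => by
    rw [← Algebra.algebraMap_eq_smul_one, ← NormedSpace.algebraMap_exp_comm,
      Algebra.algebraMap_eq_smul_one, Complex.exp_eq_exp_ℂ]
  have h := norm_exp_sub_exp_apply_le (a := (2 * Real.pi * Complex.I : ℂ) • A)
    (b := (2 * Real.pi * Complex.I * q : ℂ) • (1 : H →L[ℂ] H)) (x := x)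
    (C := 2 * Real.pi * ‖A x - (q : ℂ) • x‖)
    (by simpa using smul_mem_skewAdjoint_of_isSelfAdjoint hA 1) fun t => by
      have : t • (2 * Real.pi * Complex.I * q : ℂ) • (1 : H →L[ℂ] H) =
          (2 * Real.pi * Complex.I * q * t : ℂ) • 1 := by
        rw [← Complex.coe_smul, smul_smul]; ring_nf
      rw [this, hs, smul_apply, one_apply_eq_self, map_smul,
        norm_smul]
      have h1 : ‖Complex.exp (2 * Real.pi * Complex.I * q * t)‖ = 1 := by
        rw [Complex.norm_exp]; simp
      rw [h1, one_mul, sub_apply, smul_apply,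
        smul_apply, one_apply_eq_self, mul_smul, ← smul_sub,
        norm_smul, norm_sub_rev]
      simp [abs_of_pos Real.pi_pos]
  rw [hs, smul_apply, one_apply_eq_self, norm_sub_rev] at h
  exact h

theorem expTwoPi_add {A B : H →L[ℂ] H} (h : Commute A B) :
    expTwoPi (A + B) = expTwoPi A * expTwoPi B := by
  let _ : NormedAlgebra ℚ (H →L[ℂ] H) := NormedAlgebra.restrictScalars ℚ ℂ _
  rw [expTwoPi, smul_add, NormedSpace.exp_add_of_commute ((h.smul_left _).smul_right _)]
  rfl

theorem expTwoPi_conj {A U : H →L[ℂ] H} (hU : U ∈ unitary (H →L[ℂ] H)) :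
    expTwoPi (star U * A * U) = star U * expTwoPi A * U := by
  let _ : NormedAlgebra ℚ (H →L[ℂ] H) := NormedAlgebra.restrictScalars ℚ ℂ _
  have h := NormedSpace.exp_units_conj' (Unitary.toUnits ⟨U, hU⟩)
    ((2 * Real.pi * Complex.I : ℂ) • A)
  rw [expTwoPi, ← smul_mul_assoc, ← mul_smul_comm]
  exact h

theorem expTwoPi_zero : expTwoPi (0 : H →L[ℂ] H) = 1 := by
  simp [expTwoPi]

/-- In the continuous functional calculus only the values on the spectrum count, and `exp(2πim) = 1`
at integers. -/
theorem expTwoPi_eq_one_of_spectrum {A : H →L[ℂ] H} (hA : IsSelfAdjoint A)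
    (hs : spectrum ℂ A ⊆ Set.range ((↑) : ℤ → ℂ)) : expTwoPi A = 1 := by
  have hn : IsStarNormal A := hA.isStarNormal
  have hn2 : IsStarNormal ((2 * Real.pi * Complex.I : ℂ) • A) := inferInstance
  rw [expTwoPi, ← CFC.exp_eq_normedSpace_exp (𝕜 := ℂ),
    ← cfc_comp_smul (2 * Real.pi * Complex.I : ℂ) (NormedSpace.exp : ℂ → ℂ) A]
  · rw [← cfc_one ℂ A]
    refine cfc_congr fun z hz => ?_
    obtain ⟨m, rfl⟩ := hs hz
    rw [← Complex.exp_eq_exp_ℂ, smul_eq_mul, mul_comm]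
    exact Complex.exp_int_mul_two_pi_mul_I m

theorem expTwoPi_mem_of_isClosed (S : StarSubalgebra ℂ (H →L[ℂ] H))
    (hS : IsClosed (S : Set (H →L[ℂ] H))) {A : H →L[ℂ] H} (hA : A ∈ S) : expTwoPi A ∈ S := by
  let _ : NormedAlgebra ℚ (H →L[ℂ] H) := NormedAlgebra.restrictScalars ℚ ℂ _
  exact NormedSpace.exp_mem (R := ℂ) hS (S.smul_mem hA _)

end ExpTwoPi

/-! ### Calculus of rapidly decaying and polynomially bounded errors -/

section UniformDecay

variable {I : Type*} {ℓ : I → ℕ}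

/-- `g = O(ℓ^{-∞})` uniformly over the index set. -/
def UniformDecay (ℓ : I → ℕ) (g : I → ℝ) : Prop :=
  ∃ f : ℕ → ℝ, RapidDecay f ∧ ∀ i, g i ≤ f (ℓ i)

/-- `g` is bounded by a polynomial of `ℓ`, uniformly over the index set. -/
def PolyBounded (ℓ : I → ℕ) (g : I → ℝ) : Prop :=
  ∃ (C : ℝ) (k : ℕ), ∀ i, g i ≤ C * (ℓ i : ℝ) ^ k

theorem RapidDecay.abs {f : ℕ → ℝ} (hf : RapidDecay f) : RapidDecay fun m => |f m| :=
  hf.trans_abs_le fun m => by rw [abs_abs]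

theorem RapidDecay.sqrt {f : ℕ → ℝ} (hf : RapidDecay f) : RapidDecay fun m => √(f m) := by
  intro k
  -- Decay is used at exponent `2k` because `m^k √f = √(m^{2k} f)`.
  have h := (hf.abs (2 * k)).sqrt
  rw [Real.sqrt_zero] at h
  refine squeeze_zero (fun m => by positivity) (fun m => ?_) h
  simp only
  rw [pow_mul', Real.sqrt_mul (by positivity), Real.sqrt_sq (by positivity)]
  gcongr
  exact le_abs_self _

theorem rapidDecay_exp {c : ℝ} (hc : 0 < c) : RapidDecay fun m => Real.exp (-c * m) := by
  intro k
  have h := (tendsto_rpow_mul_exp_neg_mul_atTop_nhds_zero k c hc).comp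
    (tendsto_natCast_atTop_atTop (R := ℝ))
  refine h.congr fun m => ?_
  simp only [Function.comp_apply, Real.rpow_natCast]

theorem RapidDecay.comp_div {f : ℕ → ℝ} (hf : RapidDecay f) {a : ℕ} (ha : 0 < a) :
    RapidDecay fun m => f (m / a) := by
  intro k
  have h1 : Tendsto (fun m : ℕ => m / a) atTop atTop :=
    Nat.tendsto_div_const_atTop ha.ne'
  have h2 := ((hf.abs k).comp h1).const_mul ((2 * a : ℝ) ^ k)
  rw [mul_zero] at h2
  rw [tendsto_zero_iff_abs_tendsto_zero]
  refine squeeze_zero' (Eventually.of_forall fun m => abs_nonneg _) ?_ h2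
  filter_upwards [eventually_ge_atTop a] with m hm
  simp only [Function.comp_apply, abs_mul, abs_pow, Nat.abs_cast]
  rw [← mul_assoc, ← mul_pow]
  gcongr
  -- Rounding down loses at most a factor 2 once `m ≥ a`, whence the constant `(2a)^k`.
  have h3 : m ≤ 2 * a * (m / a) := by
    have h4 := Nat.lt_div_mul_add ha (a := m)
    have h5 : 1 ≤ m / a := (Nat.one_le_div_iff ha).2 hm
    nlinarith
  exact_mod_cast h3

theorem UniformDecay.mono {g h : I → ℝ} (hg : UniformDecay ℓ g) (hle : ∀ i, h i ≤ g i) :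
    UniformDecay ℓ h := by
  obtain ⟨f, hf, hb⟩ := hg
  exact ⟨f, hf, fun i => (hle i).trans (hb i)⟩

theorem UniformDecay.add {g h : I → ℝ} (hg : UniformDecay ℓ g) (hh : UniformDecay ℓ h) :
    UniformDecay ℓ fun i => g i + h i := by
  obtain ⟨f, hf, hb⟩ := hg
  obtain ⟨f', hf', hb'⟩ := hh
  exact ⟨f + f', hf.add hf', fun i => add_le_add (hb i) (hb' i)⟩

theorem UniformDecay.sqrt {g : I → ℝ} (hg : UniformDecay ℓ g) :
    UniformDecay ℓ fun i => √(g i) := by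
  obtain ⟨f, hf, hb⟩ := hg
  exact ⟨_, hf.sqrt, fun i => Real.sqrt_le_sqrt (hb i)⟩

theorem UniformDecay.mul_poly {g p : I → ℝ} (hg : UniformDecay ℓ g) (hp : PolyBounded ℓ p)
    (hp0 : ∀ i, 0 ≤ p i) : UniformDecay ℓ fun i => g i * p i := by
  obtain ⟨f, hf, hb⟩ := hg
  obtain ⟨C, k, hC⟩ := hp
  refine ⟨fun m => |f m| * m ^ k * C, ((hf.abs.mul_param_pow k).mul_const C), fun i => ?_⟩
  calc g i * p i ≤ |f (ℓ i)| * p i :=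
        mul_le_mul_of_nonneg_right ((hb i).trans (le_abs_self _)) (hp0 i)
    _ ≤ |f (ℓ i)| * (C * (ℓ i : ℝ) ^ k) := mul_le_mul_of_nonneg_left (hC i) (abs_nonneg _)
    _ = _ := by ring

theorem polyBounded_const (c : ℝ) : PolyBounded ℓ fun _ => c := ⟨c, 0, fun i => by simp⟩

theorem UniformDecay.const_mul {g : I → ℝ} (hg : UniformDecay ℓ g) {c : ℝ} (hc : 0 ≤ c) :
    UniformDecay ℓ fun i => c * g i :=
  (hg.mul_poly (polyBounded_const c) fun _ => hc).mono fun _ => (mul_comm _ _).le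

theorem PolyBounded.add (hℓ : ∀ i, 0 < ℓ i) {g h : I → ℝ} (hg : PolyBounded ℓ g)
    (hh : PolyBounded ℓ h) : PolyBounded ℓ fun i => g i + h i := by
  obtain ⟨C, k, hC⟩ := hg
  obtain ⟨C', k', hC'⟩ := hh
  refine ⟨|C| + |C'|, max k k', fun i => ?_⟩
  have h1 : (1 : ℝ) ≤ ℓ i := by exact_mod_cast hℓ i
  have e1 : (ℓ i : ℝ) ^ k ≤ (ℓ i : ℝ) ^ max k k' := pow_le_pow_right₀ h1 (le_max_left _ _)
  have e2 : (ℓ i : ℝ) ^ k' ≤ (ℓ i : ℝ) ^ max k k' := pow_le_pow_right₀ h1 (le_max_right _ _)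
  calc g i + h i ≤ |C| * (ℓ i : ℝ) ^ k + |C'| * (ℓ i : ℝ) ^ k' := by
        refine add_le_add ((hC i).trans ?_) ((hC' i).trans ?_)
        · gcongr; exact le_abs_self _
        · gcongr; exact le_abs_self _
    _ ≤ |C| * (ℓ i : ℝ) ^ max k k' + |C'| * (ℓ i : ℝ) ^ max k k' := by gcongr
    _ = _ := by ring

theorem PolyBounded.mul {g h : I → ℝ} (hg : PolyBounded ℓ g)
    (hh : PolyBounded ℓ h) (h0 : ∀ i, 0 ≤ h i) : PolyBounded ℓ fun i => g i * h i := by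
  obtain ⟨C, k, hC⟩ := hg
  obtain ⟨C', k', hC'⟩ := hh
  refine ⟨|C| * C', k + k', fun i => ?_⟩
  calc g i * h i ≤ (|C| * (ℓ i : ℝ) ^ k) * h i := by
        refine mul_le_mul_of_nonneg_right ((hC i).trans ?_) (h0 i)
        gcongr; exact le_abs_self _
    _ ≤ (|C| * (ℓ i : ℝ) ^ k) * (C' * (ℓ i : ℝ) ^ k') := by
        refine mul_le_mul_of_nonneg_left (hC' i) (by positivity)
    _ = _ := by ring

theorem UniformDecay.polyBounded {g : I → ℝ} (hg : UniformDecay ℓ g) : PolyBounded ℓ g := by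
  obtain ⟨f, hf, hb⟩ := hg
  have h := hf 0
  simp only [pow_zero, one_mul] at h
  obtain ⟨C, hC⟩ := h.bddAbove_range
  exact ⟨C, 0, fun i => by simpa using (hb i).trans (hC ⟨_, rfl⟩)⟩

end UniformDecay

/-! ### Geometry of the strips -/

namespace Site

theorem circleDist_triangle {L : ℕ} (a b c : ZMod L) :
    circleDist a c ≤ circleDist a b + circleDist b c := by
  have h := ZMod.natAbs_valMinAbs_add_le (a - b) (b - c)
  rw [sub_add_sub_cancel] at h
  exact h.trans (Int.natAbs_add_le _ _)

theorem circleDist_comm {L : ℕ} (a b : ZMod L) : circleDist a b = circleDist b a := by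
  rw [circleDist, circleDist, ← neg_sub, ZMod.natAbs_valMinAbs_neg]

theorem circleDist_self {L : ℕ} (a : ZMod L) : circleDist a a = 0 := by
  simp [circleDist]

theorem circleDist_natCast_zero {L k : ℕ} [NeZero L] (h : k ≤ L / 2) :
    circleDist (k : ZMod L) 0 = k := by
  rw [circleDist, sub_zero, ZMod.valMinAbs_natCast_of_le_half h]
  rfl

theorem circleDist_le_graphDist {d L : ℕ} [NeZero d] (x y : Site d L) :
    circleDist (x 0) (y 0) ≤ graphDist x y :=
  Finset.single_le_sum (f := fun i => circleDist (x i) (y i)) (fun _ _ => Nat.zero_le _)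
    (Finset.mem_univ 0)

theorem subset_fatten {d L : ℕ} [NeZero L] (X : Finset (Site d L)) (r : ℕ) :
    X ⊆ fatten X r := by
  intro x hx
  simp only [fatten, Finset.mem_filter, Finset.mem_univ, true_and]
  exact ⟨x, hx, by simp [graphDist, circleDist_self]⟩

/-- Fattening increases the distance of the first coordinates to a fixed one by at most `r`. -/
theorem circleDist_le_of_mem_fatten {d L : ℕ} [NeZero d] [NeZero L] {X : Finset (Site d L)}
    {r R : ℕ} {a : ZMod L} (hX : ∀ x ∈ X, circleDist (x 0) a ≤ R) :
    ∀ x ∈ fatten X r, circleDist (x 0) a ≤ r + R := by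
  intro x hx
  simp only [fatten, Finset.mem_filter, Finset.mem_univ, true_and] at hx
  obtain ⟨y, hy, hxy⟩ := hx
  exact (circleDist_triangle _ (y 0) _).trans
    (add_le_add ((circleDist_le_graphDist x y).trans hxy) (hX y hy))

variable (d : ℕ) [NeZero d] (L : EvenSide)

/-- Room for both the support of `K₋` and the spreading under `U`: `L/16 + L/32 = 3L/32 < L/8`. -/
theorem fatten_fatten_bdryMinus_subset :
    fatten (fatten (bdryMinus d L) ((L : ℕ) / 16)) ((L : ℕ) / 32) ⊆ stripMinus d L := by
  intro x hx
  have h := circleDist_le_of_mem_fatten (circleDist_le_of_mem_fatten (R := 0) (a := 0)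
    (X := bdryMinus d L) fun x hx => by
      simp only [bdryMinus, Finset.mem_filter, Finset.mem_univ, true_and] at hx
      simp [hx, circleDist_self]) x hx
  simp only [stripMinus, Finset.mem_filter, Finset.mem_univ, true_and]
  omega

/-- The set `∂₊` is at `L/2 - 1` while `S₊` is centred at `L/2`. This extra unit must fit into the
slack `L/8 - 3L/32 = L/32`, for which `64 ≤ L` is ample. -/
theorem fatten_fatten_bdryPlus_subset (hL : 64 ≤ (L : ℕ)) :
    fatten (fatten (bdryPlus d L) ((L : ℕ) / 16)) ((L : ℕ) / 32) ⊆ stripPlus d L := by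
  intro x hx
  have h := circleDist_le_of_mem_fatten (circleDist_le_of_mem_fatten (R := 1)
    (a := (((L : ℕ) / 2 : ℕ) : ZMod L)) (X := bdryPlus d L) fun x hx => by
      simp only [bdryPlus, Finset.mem_filter, Finset.mem_univ, true_and] at hx
      rw [hx, circleDist_comm, circleDist, sub_sub_cancel]
      have := circleDist_natCast_zero (L := L) (k := 1) (by omega)
      rw [circleDist, sub_zero, Nat.cast_one] at this
      exact this.le) x hx
  simp only [stripPlus, Finset.mem_filter, Finset.mem_univ, true_and]
  omega

variable {d L}

/-- The centres are `L/2` apart and each strip uses up at most `L/8`, leaving `L/4`. -/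
theorem le_circleDist_of_mem_strips {x y : Site d L} (hx : x ∈ stripMinus d L)
    (hy : y ∈ stripPlus d L) : (L : ℕ) ≤ 4 * circleDist (x 0) (y 0) := by
  simp only [stripMinus, stripPlus, Finset.mem_filter, Finset.mem_univ, true_and] at hx hy
  have h0 := circleDist_natCast_zero (L := L) (k := (L : ℕ) / 2) le_rfl
  have h1 := circleDist_triangle (((L : ℕ) / 2 : ℕ) : ZMod L) (y 0) 0
  have h2 := circleDist_triangle (y 0) (x 0) 0
  rw [circleDist_comm _ (y 0)] at h1
  rw [circleDist_comm (y 0) (x 0)] at h2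
  have h3 := L.2.2.two_dvd
  omega

theorem disjoint_strips : Disjoint (stripMinus d L) (stripPlus d L) := by
  rw [Finset.disjoint_left]
  intro x hx hy
  have h := le_circleDist_of_mem_strips hx hy
  rw [circleDist_self] at h
  have := L.2.1
  omega

theorem le_d1_strips : (L : ℕ) ≤ 4 * d1 (stripMinus d L) (stripPlus d L) := by
  have hne : {m | ∃ x ∈ stripMinus d L, ∃ x' ∈ stripPlus d L,
      m = circleDist (x 0) (x' 0)}.Nonempty :=
    ⟨_, fun _ => 0, by simp [stripMinus, circleDist_self],
      fun _ => (((L : ℕ) / 2 : ℕ) : ZMod L), by simp [stripPlus, circleDist_self], rfl⟩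
  obtain ⟨x, hx, y, hy, h⟩ := Nat.sInf_mem hne
  rw [d1, h]
  exact le_circleDist_of_mem_strips hx hy

omit [NeZero d] in
theorem card_le (X : Finset (Site d L)) : (X.card : ℝ) ≤ (L : ℝ) ^ d := by
  have h := Finset.card_le_univ X
  rw [Fintype.card_fun, ZMod.card, Fintype.card_fin] at h
  exact_mod_cast h

end Site

/-! ### Locality of `exp(2πi(Q + K))` for integer charges -/

section ChargeExp

variable {st : Statistics} {d n L : ℕ} [NeZero d] [NeZero L]

/-- `exp (2πi (Q + K))` with `Q` the charge of the half-torus. -/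
def chargeExp (q : Site d L → Op st d n L) (K : Op st d n L) : Op st d n L :=
  expTwoPi (halfCharge q + K)

omit [NeZero d] in
theorem charge_commute {q : Site d L → Op st d n L} (hloc : ∀ x, q x ∈ localAlg st d n L {x})
    (x y : Site d L) : Commute (q x) (q y) := by
  by_cases h : x = y
  · rw [h]
  · exact localStarAlg_commute (X := {x}) (Y := {y}) (by simpa using h)
      (mem_localStarAlg.2 (hloc x)) (mem_localStarAlg.2 (hloc y))

omit [NeZero d] in
-- Charges at different sites commute, so the exponential factorizes into on-site factors, each
-- equal to 1.
theorem expTwoPi_sum_charge {q : Site d L → Op st d n L} (hsa : ∀ x, IsSelfAdjoint (q x))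
    (hloc : ∀ x, q x ∈ localAlg st d n L {x})
    (hspec : ∀ x, spectrum ℂ (q x) ⊆ Set.range ((↑) : ℤ → ℂ)) (S : Finset (Site d L)) :
    expTwoPi (∑ x ∈ S, q x) = 1 := by
  induction S using Finset.induction_on with
  | empty => simp [expTwoPi_zero]
  | insert x S hx ih =>
    rw [Finset.sum_insert hx, expTwoPi_add (Commute.sum_right _ _ _ fun y _ =>
      charge_commute hloc x y), ih, expTwoPi_eq_one_of_spectrum (hsa x) (hspec x), one_mul]

omit [NeZero d] in
theorem sum_charge_mem {q : Site d L → Op st d n L} (hloc : ∀ x, q x ∈ localAlg st d n L {x})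
    {S X : Finset (Site d L)} (h : S ⊆ X) : ∑ x ∈ S, q x ∈ localStarAlg st d n L X :=
  sum_mem fun x hx => localStarAlg_mono (by simpa using h hx) (mem_localStarAlg.2 (hloc x))

theorem halfCharge_eq_add (q : Site d L → Op st d n L) (X : Finset (Site d L)) :
    halfCharge q = ∑ x ∈ Site.Gam d L \ X, q x + ∑ x ∈ Site.Gam d L ∩ X, q x :=
  ((add_comm _ _).trans (Finset.sum_inter_add_sum_sdiff _ _ _)).symm

/-- The part of the charge outside the support of `K` does not contribute. -/
theorem chargeExp_eq_of_mem {q : Site d L → Op st d n L} (hsa : ∀ x, IsSelfAdjoint (q x))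
    (hloc : ∀ x, q x ∈ localAlg st d n L {x})
    (hspec : ∀ x, spectrum ℂ (q x) ⊆ Set.range ((↑) : ℤ → ℂ)) {X : Finset (Site d L)}
    {K : Op st d n L} (hK : K ∈ localStarAlg st d n L X) :
    chargeExp q K = expTwoPi (∑ x ∈ Site.Gam d L ∩ X, q x + K) := by
  have hc : Commute (∑ x ∈ Site.Gam d L \ X, q x) (∑ x ∈ Site.Gam d L ∩ X, q x + K) :=
    localStarAlg_commute Finset.sdiff_disjoint (sum_charge_mem hloc subset_rfl)
      (add_mem (sum_charge_mem hloc Finset.inter_subset_right) hK)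
  rw [chargeExp, halfCharge_eq_add q X, add_assoc, expTwoPi_add hc,
    expTwoPi_sum_charge hsa hloc hspec, one_mul]

theorem chargeExp_mem {q : Site d L → Op st d n L} (hsa : ∀ x, IsSelfAdjoint (q x))
    (hloc : ∀ x, q x ∈ localAlg st d n L {x})
    (hspec : ∀ x, spectrum ℂ (q x) ⊆ Set.range ((↑) : ℤ → ℂ)) {X : Finset (Site d L)}
    {K : Op st d n L} (hK : K ∈ localStarAlg st d n L X) :
    chargeExp q K ∈ localStarAlg st d n L X := by
  rw [chargeExp_eq_of_mem hsa hloc hspec hK]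
  exact expTwoPi_mem_of_isClosed _ (localStarAlg_isClosed X)
    (add_mem (sum_charge_mem hloc Finset.inter_subset_right) hK)

/-- The charge is cut at the boundary of `X`: the part in `X` goes with `K`, the rest with `K'`, and
the two groups have disjoint supports. The charge missing from either factor has trivial
exponential. -/
theorem chargeExp_add {q : Site d L → Op st d n L} (hsa : ∀ x, IsSelfAdjoint (q x))
    (hloc : ∀ x, q x ∈ localAlg st d n L {x})
    (hspec : ∀ x, spectrum ℂ (q x) ⊆ Set.range ((↑) : ℤ → ℂ)) {X Y : Finset (Site d L)}
    (hXY : Disjoint X Y) {K K' : Op st d n L} (hK : K ∈ localStarAlg st d n L X)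
    (hK' : K' ∈ localStarAlg st d n L Y) :
    chargeExp q (K + K') = chargeExp q K * chargeExp q K' := by
  have hd : Disjoint X (Site.Gam d L \ X ∪ Y) :=
    Finset.disjoint_union_right.2 ⟨Finset.disjoint_sdiff, hXY⟩
  have h1 : ∑ x ∈ Site.Gam d L ∩ X, q x ∈ localStarAlg st d n L X :=
    sum_charge_mem hloc Finset.inter_subset_right
  have h2 : ∑ x ∈ Site.Gam d L \ X, q x + K' ∈ localStarAlg st d n L (Site.Gam d L \ X ∪ Y) :=
    add_mem (sum_charge_mem hloc Finset.subset_union_left)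
      (localStarAlg_mono Finset.subset_union_right hK')
  have e1 : chargeExp q K' = expTwoPi (∑ x ∈ Site.Gam d L \ X, q x + K') := by
    have : halfCharge q + K' =
        ∑ x ∈ Site.Gam d L ∩ X, q x + (∑ x ∈ Site.Gam d L \ X, q x + K') := by
      rw [halfCharge_eq_add q X]; abel
    rw [chargeExp, this, expTwoPi_add (localStarAlg_commute hd h1 h2),
      expTwoPi_sum_charge hsa hloc hspec, one_mul]
  have e2 : halfCharge q + (K + K') =
      (∑ x ∈ Site.Gam d L ∩ X, q x + K) + (∑ x ∈ Site.Gam d L \ X, q x + K') := by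
    rw [halfCharge_eq_add q X]; abel
  rw [chargeExp, e2, expTwoPi_add (localStarAlg_commute hd (add_mem h1 hK) h2), ← e1,
    chargeExp_eq_of_mem hsa hloc hspec hK]

theorem halfCharge_isSelfAdjoint {q : Site d L → Op st d n L}
    (hsa : ∀ x, IsSelfAdjoint (q x)) : IsSelfAdjoint (halfCharge q) := by
  unfold halfCharge
  induction Site.Gam d L using Finset.induction_on with
  | empty => exact IsSelfAdjoint.zero (Op st d n L)
  | insert x S hx ih =>
    rw [Finset.sum_insert hx]
    exact IsSelfAdjoint.add (R := Op st d n L) (hsa x) ih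

/-- A charge that splits between two commuting regions, with observables in `S` and `S'`, in the
way needed for the index: `exp (2πi Q) = 1`, and the exponentials of local perturbations of `Q` are
local. -/
structure ChargeSplitting {H : Type*} [NormedAddCommGroup H] [InnerProductSpace ℂ H]
    [CompleteSpace H] (Q : H →L[ℂ] H) (S S' : StarSubalgebra ℂ (H →L[ℂ] H)) : Prop where
  isSelfAdjoint : IsSelfAdjoint Q
  expTwoPi_eq_one : expTwoPi Q = 1
  mem_left : ∀ K ∈ S, expTwoPi (Q + K) ∈ S
  mem_right : ∀ K ∈ S', expTwoPi (Q + K) ∈ S'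
  expTwoPi_add : ∀ K ∈ S, ∀ K' ∈ S',
    expTwoPi (Q + (K + K')) = expTwoPi (Q + K) * expTwoPi (Q + K')
  exists_near_scalar : ∀ A ∈ S, ∀ B ∈ S', ∃ l : ℂ, ‖A - algebraMap ℂ _ l‖ ≤ ‖A - B‖

theorem chargeSplitting_halfCharge {q : Site d L → Op st d n L}
    (hsa : ∀ x, IsSelfAdjoint (q x)) (hloc : ∀ x, q x ∈ localAlg st d n L {x})
    (hspec : ∀ x, spectrum ℂ (q x) ⊆ Set.range ((↑) : ℤ → ℂ)) {X Y : Finset (Site d L)}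
    (hXY : Disjoint X Y) :
    ChargeSplitting (halfCharge q) (localStarAlg st d n L X) (localStarAlg st d n L Y) where
  isSelfAdjoint := halfCharge_isSelfAdjoint hsa
  expTwoPi_eq_one := expTwoPi_sum_charge hsa hloc hspec _
  mem_left _ hK := chargeExp_mem hsa hloc hspec hK
  mem_right _ hK := chargeExp_mem hsa hloc hspec hK
  expTwoPi_add _ hK _ hK' := chargeExp_add hsa hloc hspec hXY hK hK'
  exists_near_scalar _ hA _ hB := localStarAlg_exists_norm_sub_le hXY hA hB

end ChargeExp

/-! ### Dispersion of uncorrelated observables -/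

section StateEstimates

variable {H : Type*} [NormedAddCommGroup H] [InnerProductSpace ℂ H]

theorem norm_inner_apply_sub_le {Ω : H} (hΩ : ‖Ω‖ = 1) (v : H) (z : ℂ) :
    ‖inner ℂ Ω v - z‖ ≤ ‖v - z • Ω‖ := by
  have : inner ℂ Ω v - z = inner ℂ Ω (v - z • Ω) := by
    rw [inner_sub_right, inner_smul_right, inner_self_eq_norm_sq_to_K, hΩ]; simp
  have h := norm_inner_le_norm (𝕜 := ℂ) Ω (v - z • Ω)
  rwa [this, ← one_mul ‖v - z • Ω‖, ← hΩ]

theorem norm_inner_apply_le {Ω : H} (hΩ : ‖Ω‖ = 1) (A : H →L[ℂ] H) :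
    ‖inner ℂ Ω (A Ω)‖ ≤ ‖A‖ := by
  have h1 := norm_inner_le_norm (𝕜 := ℂ) Ω (A Ω)
  have h2 := A.le_opNorm Ω
  rw [hΩ] at h1 h2
  linarith

theorem norm_sub_inner_smul_sq {Ω : H} (hΩ : ‖Ω‖ = 1) (v : H) :
    ‖v - (inner ℂ Ω v : ℂ) • Ω‖ ^ 2 = ‖v‖ ^ 2 - ‖inner ℂ Ω v‖ ^ 2 := by
  have h := norm_sub_sq (𝕜 := ℂ) v ((inner ℂ Ω v : ℂ) • Ω)
  rw [inner_smul_right, ← inner_conj_symm v Ω, norm_smul, hΩ, mul_one, RCLike.mul_conj] at h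
  have e : RCLike.re ((‖(inner ℂ Ω v : ℂ)‖ : ℂ) ^ 2) = ‖(inner ℂ Ω v : ℂ)‖ ^ 2 := by
    norm_cast
  have h' : RCLike.re (((‖(inner ℂ Ω v : ℂ)‖ : ℝ) : ℂ) ^ 2) = ‖(inner ℂ Ω v : ℂ)‖ ^ 2 := e
  linarith [h.trans (congrArg (fun r => ‖v‖ ^ 2 - 2 * r + ‖(inner ℂ Ω v : ℂ)‖ ^ 2) h')]

variable [CompleteSpace H]

/-- Two observables with small covariance whose sum has small dispersion have small dispersion. -/
theorem norm_sub_sq_le_of_cov {Ω : H} (hΩ : ‖Ω‖ = 1) {A B : H →L[ℂ] H} (hA : IsSelfAdjoint A)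
    {ε κ : ℝ} (hε : ‖(A + B) Ω‖ ≤ ε)
    (hκ : ‖inner ℂ Ω ((A * B) Ω) - inner ℂ Ω (A Ω) * inner ℂ Ω (B Ω)‖ ≤ κ) :
    ‖A Ω - (inner ℂ Ω (A Ω) : ℂ) • Ω‖ ^ 2 ≤ 4 * ‖A‖ * ε + κ := by
  set α : ℂ := inner ℂ Ω (A Ω) with hα
  set β : ℂ := inner ℂ Ω (B Ω) with hβ
  set a := A Ω - α • Ω with ha
  set b := B Ω - β • Ω with hb
  have h1 : ∀ u : H, inner ℂ (A Ω) u = inner ℂ Ω (A u) := fun u => by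
    rw [← ContinuousLinearMap.adjoint_inner_right, ← ContinuousLinearMap.star_eq_adjoint,
      hA.star_eq]
  have h2 : (starRingEnd ℂ) α = α := by
    rw [hα, inner_conj_symm, h1]
  have hΩΩ : (inner ℂ Ω Ω : ℂ) = 1 := by rw [inner_self_eq_norm_sq_to_K, hΩ]; simp
  have hab : inner ℂ a b = inner ℂ Ω ((A * B) Ω) - α * β := by
    rw [ha, hb, inner_sub_left, inner_sub_right, inner_sub_right, inner_smul_left,
      inner_smul_right, inner_smul_left, inner_smul_right, h1, h1, hΩΩ, h2, ← hα, ← hβ]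
    simp only [mul_apply_eq_comp]
    ring
  have hsum : ‖a + b‖ ≤ 2 * ε := by
    have e : a + b = (A + B) Ω - (inner ℂ Ω ((A + B) Ω) : ℂ) • Ω := by
      rw [add_apply, inner_add_right, ha, hb, ← hα, ← hβ, add_smul]; abel
    have h3 : ‖(inner ℂ Ω ((A + B) Ω) : ℂ) • Ω‖ ≤ ε := by
      rw [norm_smul, hΩ, mul_one]
      refine (norm_inner_le_norm _ _).trans ?_
      rwa [hΩ, one_mul]
    rw [e]
    linarith [norm_sub_le ((A + B) Ω) ((inner ℂ Ω ((A + B) Ω) : ℂ) • Ω)]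
  have han : ‖a‖ ≤ 2 * ‖A‖ := by
    have h4 := norm_sub_le (A Ω) (α • Ω)
    have h5 := A.le_opNorm Ω
    have h6 := norm_inner_apply_le hΩ A
    rw [norm_smul, hΩ, mul_one] at h4
    rw [hΩ, mul_one] at h5
    linarith
  -- With centred vectors `a`, `b`: `‖a‖² = ⟨a, a + b⟩ - ⟨a, b⟩`. The first term is small because
  -- the sum has small dispersion, the second is the covariance.
  have e : (inner ℂ a a : ℂ) = inner ℂ a (a + b) - inner ℂ a b := by
    rw [inner_add_right]; ring
  have h7 : ‖a‖ ^ 2 = ‖(inner ℂ a a : ℂ)‖ := by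
    rw [inner_self_eq_norm_sq_to_K]; simp
  rw [h7, e]
  refine (norm_sub_le _ _).trans (add_le_add ?_ (by rw [hab]; exact hκ))
  refine (norm_inner_le_norm _ _).trans ?_
  calc ‖a‖ * ‖a + b‖ ≤ (2 * ‖A‖) * (2 * ε) := by gcongr
    _ = _ := by ring

theorem norm_apply_of_mem_unitary {V : H →L[ℂ] H} (hV : V ∈ unitary (H →L[ℂ] H)) (x : H) :
    ‖V x‖ = ‖x‖ :=
  Unitary.norm_map ⟨V, hV⟩ x

/-- If the product of two uncorrelated unitaries has `Ω` as approximate eigenvector, so has each of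
the two. -/
theorem unitary_dispersion_of_cov {Ω : H} (hΩ : ‖Ω‖ = 1) {Z Z' : H →L[ℂ] H}
    (hZ : Z ∈ unitary (H →L[ℂ] H)) (hZ' : Z' ∈ unitary (H →L[ℂ] H)) {w : ℂ} (hw : ‖w‖ = 1)
    {ε κ : ℝ} (hε : ‖(Z * Z') Ω - w • Ω‖ ≤ ε)
    (hκ : ‖inner ℂ Ω ((Z * Z') Ω) - inner ℂ Ω (Z Ω) * inner ℂ Ω (Z' Ω)‖ ≤ κ) :
    ‖inner ℂ Ω (Z Ω) * inner ℂ Ω (Z' Ω) - w‖ ≤ ε + κ ∧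
    ‖Z Ω - (inner ℂ Ω (Z Ω) : ℂ) • Ω‖ ^ 2 ≤ 2 * (ε + κ) ∧
    ‖Z' Ω - (inner ℂ Ω (Z' Ω) : ℂ) • Ω‖ ^ 2 ≤ 2 * (ε + κ) := by
  set z : ℂ := inner ℂ Ω (Z Ω)
  set z' : ℂ := inner ℂ Ω (Z' Ω)
  have h1 := (norm_inner_apply_sub_le hΩ ((Z * Z') Ω) w).trans hε
  have h2 : ‖z * z' - w‖ ≤ ε + κ := by
    have := norm_sub_le_norm_sub_add_norm_sub (z * z') (inner ℂ Ω ((Z * Z') Ω)) w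
    rw [norm_sub_rev (z * z') (inner ℂ Ω ((Z * Z') Ω))] at this
    linarith
  have hz : ‖z‖ ≤ 1 := by
    have := norm_inner_le_norm (𝕜 := ℂ) Ω (Z Ω)
    rwa [norm_apply_of_mem_unitary hZ, hΩ, one_mul] at this
  have hz' : ‖z'‖ ≤ 1 := by
    have := norm_inner_le_norm (𝕜 := ℂ) Ω (Z' Ω)
    rwa [norm_apply_of_mem_unitary hZ', hΩ, one_mul] at this
  -- Both moduli are at most 1 and their product is nearly 1, so each is nearly 1. For a unitary the
  -- dispersion is `1 - |z|² ≤ 2(1 - |z|)`, whence the factor 2.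
  have h3 : 1 ≤ ‖z‖ * ‖z'‖ + (ε + κ) := by
    have := norm_sub_norm_le w (z * z')
    rw [hw, norm_mul, norm_sub_rev] at this
    linarith
  refine ⟨h2, ?_, ?_⟩
  · rw [norm_sub_inner_smul_sq hΩ, norm_apply_of_mem_unitary hZ, hΩ]
    nlinarith [norm_nonneg z, norm_nonneg z']
  · rw [norm_sub_inner_smul_sq hΩ, norm_apply_of_mem_unitary hZ', hΩ]
    nlinarith [norm_nonneg z, norm_nonneg z']

end StateEstimates

/-! ### Normalization of a nearly scalar exponential -/

section Shift

variable {H : Type*} [NormedAddCommGroup H] [InnerProductSpace ℂ H] [CompleteSpace H]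

theorem isSelfAdjoint_algebraMap_ofReal (r : ℝ) :
    IsSelfAdjoint (algebraMap ℂ (H →L[ℂ] H) (r : ℂ)) := by
  rw [IsSelfAdjoint, ← algebraMap_star_comm]
  simp

/-- `A - Re l` is the self-adjoint part of `A - l`, and taking self-adjoint parts does not increase
the norm. This keeps shifts self-adjoint. -/
theorem norm_sub_algebraMap_re_le {A : H →L[ℂ] H} (hA : IsSelfAdjoint A) (l : ℂ) :
    ‖A - algebraMap ℂ _ (l.re : ℂ)‖ ≤ ‖A - algebraMap ℂ _ l‖ := by
  have e : A - algebraMap ℂ _ (l.re : ℂ) =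
      (1 / 2 : ℂ) • ((A - algebraMap ℂ _ l) + star (A - algebraMap ℂ _ l)) := by
    rw [star_sub, hA.star_eq, ← algebraMap_star_comm, Complex.re_eq_add_conj]
    simp only [Algebra.algebraMap_eq_smul_one, Complex.star_def]
    module
  rw [e, norm_smul]
  have h := norm_add_le (A - algebraMap ℂ _ l) (star (A - algebraMap ℂ _ l))
  rw [norm_star] at h
  simp only [one_div, norm_inv, Complex.norm_ofNat]
  linarith

theorem norm_algebraMap_ofReal [Nontrivial H] (r : ℝ) :
    ‖algebraMap ℂ (H →L[ℂ] H) (r : ℂ)‖ = |r| := by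
  rw [norm_algebraMap']
  simp

/-- The largest spectral value of a self-adjoint `X`, computed with an auxiliary `c ≥ ‖X‖`. -/
def topValue (c : ℝ) (X : H →L[ℂ] H) : ℝ := ‖X + algebraMap ℂ _ (c : ℂ)‖ - c

theorem continuous_topValue (c : ℝ) : Continuous (topValue (H := H) c) := by
  unfold topValue; fun_prop

theorem abs_topValue_le [Nontrivial H] {c : ℝ} {X : H →L[ℂ] H} (hc : ‖X‖ ≤ c) :
    |topValue c X| ≤ ‖X‖ := by
  have hc0 : 0 ≤ c := (norm_nonneg _).trans hc
  have h1 := norm_add_le X (algebraMap ℂ _ (c : ℂ))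
  have h2 := norm_sub_le_norm_add (algebraMap ℂ (H →L[ℂ] H) (c : ℂ)) X
  rw [norm_algebraMap_ofReal, abs_of_nonneg hc0] at h1 h2
  rw [add_comm (algebraMap _ _ _)] at h2
  rw [topValue, abs_le]
  constructor <;> linarith

/-- `X + c` is positive, so its norm belongs to its spectrum. Expressing the top of the spectrum by
a norm also makes its continuity immediate. -/
theorem zero_mem_spectrum_sub_topValue [Nontrivial H] {c : ℝ} {X : H →L[ℂ] H}
    (hX : IsSelfAdjoint X) (hc : ‖X‖ ≤ c) :
    (0 : ℂ) ∈ spectrum ℂ (X - algebraMap ℂ _ (topValue c X : ℂ)) := by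
  set P : H →L[ℂ] H := X + algebraMap ℂ _ (c : ℂ) with hP
  have h0 : 0 ≤ P := by
    have h1 := hX.neg_algebraMap_norm_le_self
    have h2 : algebraMap ℝ (H →L[ℂ] H) ‖X‖ ≤ algebraMap ℝ (H →L[ℂ] H) c :=
      algebraMap_mono _ hc
    have h3 : algebraMap ℂ (H →L[ℂ] H) (c : ℂ) = algebraMap ℝ (H →L[ℂ] H) c := rfl
    rw [hP, h3]
    calc (0 : H →L[ℂ] H) = -algebraMap ℝ (H →L[ℂ] H) ‖X‖ + algebraMap ℝ (H →L[ℂ] H) ‖X‖ := by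
          rw [neg_add_cancel]
      _ ≤ _ := add_le_add h1 h2
  have h4 : ‖P‖ ∈ spectrum ℝ P := CStarAlgebra.norm_mem_spectrum_of_nonneg h0
  have h5 : ((‖P‖ : ℝ) : ℂ) ∈ spectrum ℂ P := spectrum.algebraMap_mem ℂ h4
  rw [spectrum.mem_iff] at h5 ⊢
  convert h5 using 2
  rw [map_zero, topValue, ← hP, Complex.ofReal_sub, map_sub, hP]
  abel

theorem expTwoPi_sub_algebraMap (X : H →L[ℂ] H) (r : ℝ) :
    expTwoPi (X - algebraMap ℂ _ (r : ℂ)) =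
      Complex.exp (-(2 * Real.pi * Complex.I * r)) • expTwoPi X := by
  rw [sub_eq_add_neg, expTwoPi_add (Algebra.commute_algebraMap_right (r : ℂ) X).neg_right]
  have : expTwoPi (-algebraMap ℂ (H →L[ℂ] H) (r : ℂ)) =
      algebraMap ℂ _ (Complex.exp (-(2 * Real.pi * Complex.I * r))) := by
    rw [expTwoPi, ← map_neg, Algebra.smul_def, ← map_mul, Complex.exp_eq_exp_ℂ,
      NormedSpace.algebraMap_exp_comm]
    congr 2; ring
  rw [this, ← Algebra.commutes, Algebra.smul_def]

/-- A self-adjoint operator whose exponential is nearly scalar has nearly integer spectrum after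
subtraction of its largest spectral value. -/
theorem norm_expTwoPi_sub_topValue_sub_one_le [Nontrivial H] {c : ℝ} {X : H →L[ℂ] H}
    (hX : IsSelfAdjoint X) (hc : ‖X‖ ≤ c) (l : ℂ) :
    ‖expTwoPi (X - algebraMap ℂ _ (topValue c X : ℂ)) - 1‖ ≤
      2 * ‖expTwoPi X - algebraMap ℂ _ l‖ := by
  set z : ℂ := Complex.exp (-(2 * Real.pi * Complex.I * (topValue c X : ℝ))) with hz
  have hz1 : ‖z‖ = 1 := by rw [hz, Complex.norm_exp]; simp
  set E := expTwoPi (X - algebraMap ℂ _ (topValue c X : ℂ)) with hE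
  have e1 : E - algebraMap ℂ _ (z * l) = z • (expTwoPi X - algebraMap ℂ _ l) := by
    rw [hE, expTwoPi_sub_algebraMap, smul_sub, map_mul, Algebra.smul_def z (algebraMap _ _ l)]
  have h1 : ‖E - algebraMap ℂ _ (z * l)‖ = ‖expTwoPi X - algebraMap ℂ _ l‖ := by
    rw [e1, norm_smul, hz1, one_mul]
  -- After the shift 0 is a spectral value, hence 1 is one of the exponential. So any scalar near
  -- `E` is equally near 1, which costs the factor 2.
  have h2 : (1 : ℂ) ∈ spectrum ℂ E := by
    have h3 : (0 : ℂ) ∈ spectrum ℂ ((2 * Real.pi * Complex.I : ℂ) •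
        (X - algebraMap ℂ _ (topValue c X : ℂ))) := by
      have hu : (2 * Real.pi * Complex.I : ℂ) ≠ 0 := Complex.two_pi_I_ne_zero
      have := spectrum.smul_mem_smul_iff (r := Units.mk0 _ hu)
        |>.2 (zero_mem_spectrum_sub_topValue hX hc)
      simpa [Units.smul_def] using this
    have := spectrum.exp_mem_exp _ h3
    rwa [NormedSpace.exp_zero] at this
  have h4 : 1 - z * l ∈ spectrum ℂ (E - algebraMap ℂ _ (z * l)) := by
    rw [spectrum.mem_iff] at h2 ⊢
    rwa [map_sub, sub_sub_sub_cancel_right]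
  have h5 := spectrum.norm_le_norm_of_mem h4
  have h6 : ‖algebraMap ℂ (H →L[ℂ] H) (z * l) - 1‖ ≤ ‖1 - z * l‖ := by
    rw [← map_one (algebraMap ℂ (H →L[ℂ] H)), ← map_sub, norm_algebraMap', norm_sub_rev]
  have h7 := norm_sub_le_norm_sub_add_norm_sub E (algebraMap ℂ _ (z * l)) 1
  linarith

/-- Places a unitary of the left strip near an element of the right strip's algebra, so that the
distance-to-scalars estimate applies. -/
theorem norm_sub_star_le_of_mem_unitary {V W : H →L[ℂ] H} (hW : W ∈ unitary (H →L[ℂ] H)) :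
    ‖V - star W‖ ≤ ‖V * W - 1‖ := by
  have e : V - star W = (V * W - 1) * star W := by
    rw [sub_mul, mul_assoc, Unitary.mul_star_self_of_mem hW, mul_one, one_mul]
  rw [e]
  exact (CStarRing.norm_mul_mem_unitary _ (Unitary.star_mem hW)).le

end Shift

/-! ### Existence of continuous transport operators -/

section Existence

theorem sub_sub_sub_add_cancel {G : Type*} [AddCommGroup G] (x a b m : G) :
    x - (a - m) - (b + m) = x - a - b := by
  abel

variable {H : Type*} [NormedAddCommGroup H] [InnerProductSpace ℂ H] [CompleteSpace H]

theorem norm_conj_unitary_le {U Q : H →L[ℂ] H} (hU : U ∈ unitary (H →L[ℂ] H)) :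
    ‖star U * Q * U‖ = ‖Q‖ := by
  rw [CStarRing.norm_mul_mem_unitary _ hU, CStarRing.norm_mem_unitary_mul _ (Unitary.star_mem hU)]

theorem isSelfAdjoint_star_mul_mul {U Q : H →L[ℂ] H} (hQ : IsSelfAdjoint Q) :
    IsSelfAdjoint (star U * Q * U) := by
  rw [IsSelfAdjoint, star_mul, star_mul, hQ.star_eq, star_star, mul_assoc]

/-- After a real shift, the two parts of a splitting are bounded by their sum. -/
theorem exists_bounded_splitting {Q : H →L[ℂ] H} {S S' : StarSubalgebra ℂ (H →L[ℂ] H)}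
    (hc : ChargeSplitting Q S S') {A B : H →L[ℂ] H} (hA : A ∈ S) (hB : B ∈ S')
    (hAsa : IsSelfAdjoint A) (hBsa : IsSelfAdjoint B) :
    ∃ A' ∈ S, ∃ B' ∈ S', IsSelfAdjoint A' ∧ IsSelfAdjoint B' ∧ A' + B' = A + B ∧
      ‖A'‖ ≤ ‖A + B‖ ∧ ‖B'‖ ≤ 2 * ‖A + B‖ := by
  -- Charge conservation bounds only the sum: a large scalar could be added to `A` and subtracted
  -- from `B`. It is the only freedom, since `A` differs from an element of `S'` by `A + B`.
  obtain ⟨l, hl⟩ := hc.exists_near_scalar A hA (-B) (neg_mem hB)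
  rw [sub_neg_eq_add] at hl
  have h1 := (norm_sub_algebraMap_re_le hAsa l).trans hl
  have hsa := isSelfAdjoint_algebraMap_ofReal (H := H) l.re
  refine ⟨A - algebraMap ℂ _ (l.re : ℂ), sub_mem hA (S.algebraMap_mem _),
    B + algebraMap ℂ _ (l.re : ℂ), add_mem hB (S'.algebraMap_mem _), hAsa.sub hsa, hBsa.add hsa,
    by abel, h1, ?_⟩
  have e : B + algebraMap ℂ _ (l.re : ℂ) = (A + B) - (A - algebraMap ℂ _ (l.re : ℂ)) := by abel
  rw [e]
  linarith [norm_sub_le (A + B) (A - algebraMap ℂ _ (l.re : ℂ))]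

/-- The admissible pairs for a given operator `F` form a convex set. -/
theorem convex_splittings (S S' : StarSubalgebra ℂ (H →L[ℂ] H)) (F : H →L[ℂ] H) (a b c : ℝ) :
    Convex ℝ {p : (H →L[ℂ] H) × (H →L[ℂ] H) | (p.1 ∈ S ∧ IsSelfAdjoint p.1 ∧ ‖p.1‖ ≤ a) ∧
      (p.2 ∈ S' ∧ IsSelfAdjoint p.2 ∧ ‖p.2‖ ≤ b) ∧ ‖F - p.1 - p.2‖ ≤ c} := by
  have hn : ∀ {X Y : H →L[ℂ] H} {r u v : ℝ}, ‖X‖ ≤ r → ‖Y‖ ≤ r → 0 ≤ u → 0 ≤ v → u + v = 1 →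
      ‖u • X + v • Y‖ ≤ r := fun {X Y r u v} hX hY hu hv huv => by
    have := convexOn_norm (convex_univ (𝕜 := ℝ) (E := H →L[ℂ] H)) |>.2 (mem_univ X) (mem_univ Y)
      hu hv huv
    simp only [smul_eq_mul] at this
    calc _ ≤ _ := this
      _ ≤ u * r + v * r := by gcongr
      _ = r := by rw [← add_mul, huv, one_mul]
  have hm : ∀ (S : StarSubalgebra ℂ (H →L[ℂ] H)) {X : H →L[ℂ] H} (u : ℝ), X ∈ S → u • X ∈ S :=
    fun S X u hX => by
      rw [← Complex.coe_smul]; exact S.smul_mem hX _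
  rintro ⟨X, Y⟩ ⟨⟨h1, h2, h3⟩, ⟨h4, h5, h6⟩, h7⟩ ⟨X', Y'⟩ ⟨⟨h1', h2', h3'⟩, ⟨h4', h5', h6'⟩, h7'⟩
    u v hu hv huv
  have hsa : ∀ {X : H →L[ℂ] H} (u : ℝ), IsSelfAdjoint X → IsSelfAdjoint (u • X) :=
    fun u hX => (IsSelfAdjoint.all u).smul hX
  refine ⟨⟨add_mem (hm S u h1) (hm S v h1'), (hsa u h2).add (hsa v h2'), hn h3 h3' hu hv huv⟩,
    ⟨add_mem (hm S' u h4) (hm S' v h4'), (hsa u h5).add (hsa v h5'), hn h6 h6' hu hv huv⟩, ?_⟩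
  have e : F - (u • (X, Y) + v • (X', Y')).1 - (u • (X, Y) + v • (X', Y')).2 =
      u • (F - X - Y) + v • (F - X' - Y') := by
    have : F = u • F + v • F := by rw [← add_smul, huv, one_smul]
    simp only [Prod.fst_add, Prod.snd_add, Prod.smul_fst, Prod.smul_snd, smul_sub]
    nth_rewrite 1 [this]
    abel
  rw [e]
  exact hn h7 h7' hu hv huv

/-- `U* Q U` has integer spectrum like `Q`, thus trivial exponential, and `Q + A + B` approximates
it. -/
theorem norm_expTwoPi_sub_scalar_le {Q : H →L[ℂ] H} {S S' : StarSubalgebra ℂ (H →L[ℂ] H)}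
    (hc : ChargeSplitting Q S S') {U A B : H →L[ℂ] H} (hU : U ∈ unitary (H →L[ℂ] H))
    (hA : A ∈ S) (hB : B ∈ S') (hAsa : IsSelfAdjoint A) (hBsa : IsSelfAdjoint B) :
    ‖expTwoPi (Q + A) * expTwoPi (Q + B) - 1‖ ≤
      2 * Real.pi * ‖(star U * Q * U - Q) - A - B‖ := by
  rw [← hc.expTwoPi_add A hA B hB]
  have h1 : expTwoPi (star U * Q * U) = 1 := by
    rw [expTwoPi_conj hU, hc.expTwoPi_eq_one, mul_one, Unitary.star_mul_self_of_mem hU]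
  have h2 := norm_expTwoPi_sub_le (A := star U * Q * U) (B := Q + (A + B))
    (isSelfAdjoint_star_mul_mul hc.isSelfAdjoint) (hc.isSelfAdjoint.add (hAsa.add hBsa))
  rw [h1, norm_sub_rev _ (star U * Q * U)] at h2
  have e : star U * Q * U - Q - A - B = star U * Q * U - (Q + (A + B)) := by abel
  rwa [e]

/-- Continuous families of transport operators exist. -/
theorem exists_continuousOn_transport [Nontrivial H] {Q : H →L[ℂ] H}
    {S S' : StarSubalgebra ℂ (H →L[ℂ] H)} (hc : ChargeSplitting Q S S') {U : ℝ → H →L[ℂ] H}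
    (hU : ∀ s ∈ Icc (-1 : ℝ) 1, U s ∈ unitary (H →L[ℂ] H))
    (hUc : ContinuousOn U (Icc (-1) 1)) {ε δ : ℝ} (hδ : 0 < δ)
    (h : ∀ s ∈ Icc (-1 : ℝ) 1, ∃ A ∈ S, ∃ B ∈ S', IsSelfAdjoint A ∧ IsSelfAdjoint B ∧
      ‖(star (U s) * Q * U s - Q) - A - B‖ ≤ ε) :
    ∃ Tm Tp : ℝ → H →L[ℂ] H, ContinuousOn Tm (Icc (-1) 1) ∧ ∀ s ∈ Icc (-1 : ℝ) 1,
      (IsSelfAdjoint (Tm s) ∧ IsSelfAdjoint (Tp s)) ∧ (Tm s ∈ S ∧ Tp s ∈ S') ∧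
      ‖(star (U s) * Q * U s - Q) - Tm s - Tp s‖ ≤ ε + δ ∧
      ‖expTwoPi (Q + Tm s) - 1‖ ≤ 4 * Real.pi * (ε + δ) ∧
      ‖Tm s‖ ≤ 7 * ‖Q‖ + 3 * ε ∧ ‖Tp s‖ ≤ 7 * ‖Q‖ + 3 * ε := by
  have hneg : (-1 : ℝ) ≤ 1 := by norm_num
  set N := 2 * ‖Q‖ + ε with hN
  let F : Icc (-1 : ℝ) 1 → H →L[ℂ] H := fun s => star (U s) * Q * U s - Q
  have hUc' : Continuous fun s : Icc (-1 : ℝ) 1 => U s := continuousOn_iff_continuous_domRestrict.1 hUc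
  have hF : Continuous F :=
    (((continuous_star.comp hUc').mul continuous_const).mul hUc').sub continuous_const
  have hFn : ∀ s, ‖F s‖ ≤ 2 * ‖Q‖ := fun s => by
    have := norm_sub_le (star (U s) * Q * U s) Q
    rw [norm_conj_unitary_le (hU s s.2)] at this
    linarith
  -- Convexity and a partition of unity: a splitting at `s`, held constant, works near `s` because
  -- `F` is continuous; the margin `δ` absorbs the change of `F`.
  obtain ⟨g, hg⟩ := exists_continuous_forall_mem_convex_of_local_const
    (fun s : Icc (-1 : ℝ) 1 => convex_splittings S S' (F s) N (2 * N) (ε + δ)) (fun s => by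
      obtain ⟨A, hA, B, hB, hAsa, hBsa, hAB⟩ := h s s.2
      obtain ⟨A', hA', B', hB', hAsa', hBsa', he, hAn, hBn⟩ :=
        exists_bounded_splitting hc hA hB hAsa hBsa
      have hAB' : ‖A + B‖ ≤ N := by
        have h1 := norm_sub_norm_le (A + B) (F s)
        rw [norm_sub_rev (A + B), ← sub_sub] at h1
        linarith [hFn s]
      refine ⟨(A', B'), ?_⟩
      have h2 : ∀ᶠ y in 𝓝 s, ‖F y - F s‖ < δ := by
        exact (tendsto_iff_norm_sub_tendsto_zero.1 (hF.tendsto s)).eventually_lt_const hδ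
      filter_upwards [h2] with y hy
      refine ⟨⟨hA', hAsa', hAn.trans hAB'⟩, ⟨hB', hBsa', hBn.trans (by linarith)⟩, ?_⟩
      have e : F y - A' - B' = (F s - A - B) + (F y - F s) := by
        rw [sub_sub, he]; abel
      rw [e]
      exact (norm_add_le _ _).trans (add_le_add hAB hy.le))
  -- A bound for `‖Q + A s‖` uniform in `s`, so that a single constant defines the shift `μ` and `μ`
  -- is continuous.
  set c := ‖Q‖ + N with hc'
  let A : ℝ → H →L[ℂ] H := fun s => (g (projIcc (-1) 1 hneg s)).1
  let B : ℝ → H →L[ℂ] H := fun s => (g (projIcc (-1) 1 hneg s)).2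
  let μ : ℝ → ℝ := fun s => topValue c (Q + A s)
  have hAc : Continuous A := continuous_fst.comp (g.continuous.comp continuous_projIcc)
  have hμc : Continuous μ := (continuous_topValue c).comp (continuous_const.add hAc)
  refine ⟨fun s => A s - algebraMap ℂ _ (μ s : ℂ), fun s => B s + algebraMap ℂ _ (μ s : ℂ),
    ?_, fun s hs => ?_⟩
  · refine (hAc.sub ?_).continuousOn
    exact (continuous_algebraMap ℂ _).comp (Complex.continuous_ofReal.comp hμc)
  have hps : (projIcc (-1) 1 hneg s : ℝ) = s := by rw [projIcc_of_mem hneg hs]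
  obtain ⟨⟨h1, h2, h3⟩, ⟨h4, h5, h6⟩, h7⟩ := hg (projIcc (-1) 1 hneg s)
  simp only [F, hps] at h7
  change A s ∈ S at h1
  change IsSelfAdjoint (A s) at h2
  change ‖A s‖ ≤ N at h3
  change B s ∈ S' at h4
  change IsSelfAdjoint (B s) at h5
  change ‖B s‖ ≤ 2 * N at h6
  change ‖(star (U s) * Q * U s - Q) - A s - B s‖ ≤ ε + δ at h7
  have hX : ‖Q + A s‖ ≤ c := (norm_add_le _ _).trans (by linarith)
  have hXsa : IsSelfAdjoint (Q + A s) := hc.isSelfAdjoint.add h2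
  have hμ : ‖algebraMap ℂ (H →L[ℂ] H) (μ s : ℂ)‖ ≤ c := by
    rw [norm_algebraMap_ofReal]
    exact (abs_topValue_le hX).trans hX
  have hsa := isSelfAdjoint_algebraMap_ofReal (H := H) (μ s)
  refine ⟨⟨h2.sub hsa, h5.add hsa⟩, ⟨sub_mem h1 (S.algebraMap_mem _),
    add_mem h4 (S'.algebraMap_mem _)⟩, ?_, ?_, ?_, ?_⟩
  · exact (congrArg norm (sub_sub_sub_add_cancel _ _ _ _)).le.trans h7
  · have h8 := norm_expTwoPi_sub_scalar_le hc (hU s hs) h1 h4 h2 h5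
    have hW : expTwoPi (Q + B s) ∈ unitary (H →L[ℂ] H) :=
      expTwoPi_mem_unitary (hc.isSelfAdjoint.add h5)
    have h9 := norm_sub_star_le_of_mem_unitary (V := expTwoPi (Q + A s)) hW
    obtain ⟨l, hl⟩ := hc.exists_near_scalar _ (hc.mem_left _ h1) _ (star_mem (hc.mem_right _ h4))
    have h10 := norm_expTwoPi_sub_topValue_sub_one_le hXsa hX l
    rw [← add_sub_assoc]
    have h11 : 2 * Real.pi * ‖(star (U s) * Q * U s - Q) - A s - B s‖ ≤
        2 * Real.pi * (ε + δ) := by gcongr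
    calc _ ≤ _ := h10
      _ ≤ 2 * (2 * Real.pi * (ε + δ)) := by gcongr; linarith
      _ = _ := by ring
  · refine (norm_sub_le _ _).trans ?_
    have h0 := norm_nonneg Q
    have h0' := (norm_nonneg _).trans h6
    linarith
  · refine (norm_add_le _ _).trans ?_
    have h0 := norm_nonneg Q
    linarith

end Existence

/-! ### Dressed transport operators and their dispersion -/

section Index

variable {H : Type*} [NormedAddCommGroup H] [InnerProductSpace ℂ H] [CompleteSpace H]

theorem ofReal_re_inner_of_isSelfAdjoint {A : H →L[ℂ] H} (hA : IsSelfAdjoint A) (Ω : H) :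
    (((inner ℂ Ω (A Ω) : ℂ).re : ℝ) : ℂ) = inner ℂ Ω (A Ω) := by
  rw [← Complex.conj_eq_iff_re, inner_conj_symm, ← ContinuousLinearMap.adjoint_inner_right,
    ← ContinuousLinearMap.star_eq_adjoint, hA.star_eq]

omit [CompleteSpace H] in
theorem norm_apply_le_of_norm_one {Ω : H} (hΩ : ‖Ω‖ = 1) (A : H →L[ℂ] H) : ‖A Ω‖ ≤ ‖A‖ := by
  simpa [hΩ] using A.le_opNorm Ω

theorem norm_inner_unitary_le {Ω : H} (hΩ : ‖Ω‖ = 1) {U : H →L[ℂ] H}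
    (hU : U ∈ unitary (H →L[ℂ] H)) : ‖(inner ℂ Ω (U Ω) : ℂ)‖ ≤ 1 := by
  have := norm_inner_le_norm (𝕜 := ℂ) Ω (U Ω)
  rwa [norm_apply_of_mem_unitary hU, hΩ, one_mul] at this

/-- Conjugation with a unitary that nearly fixes `Ω` preserves approximate eigenvectors. -/
theorem norm_conj_apply_sub_le {Ω : H} (hΩ : ‖Ω‖ = 1) {U A : H →L[ℂ] H}
    (hU : U ∈ unitary (H →L[ℂ] H)) {ε η : ℝ} {z : ℂ}
    (hε : ‖U Ω - (inner ℂ Ω (U Ω) : ℂ) • Ω‖ ≤ ε) (hη : ‖A Ω - z • Ω‖ ≤ η) :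
    ‖(star U * A * U) Ω - z • Ω‖ ≤ (‖A‖ + ‖z‖) * ε + η := by
  set u : ℂ := inner ℂ Ω (U Ω)
  have hu : ‖u‖ ≤ 1 := norm_inner_unitary_le hΩ hU
  have hUU : star U (U Ω) = Ω := by
    rw [← mul_apply_eq_comp, Unitary.star_mul_self_of_mem hU, one_apply_eq_self]
  have e : (star U * A * U) Ω - z • Ω = star U (A (U Ω) - z • U Ω) := by
    rw [map_sub, map_smul, hUU]; rfl
  have e2 : A (U Ω) - z • U Ω = (A (U Ω - u • Ω) - z • (U Ω - u • Ω)) + u • (A Ω - z • Ω) := by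
    rw [map_sub, map_smul, smul_sub, smul_sub, smul_comm z u]; abel
  rw [e, norm_apply_of_mem_unitary (Unitary.star_mem hU), e2]
  refine (norm_add_le _ _).trans (add_le_add ?_ ?_)
  · refine (norm_sub_le _ _).trans ?_
    rw [norm_smul, add_mul]
    refine add_le_add ((A.le_opNorm _).trans ?_) ?_ <;> gcongr
  · rw [norm_smul]
    calc ‖u‖ * ‖A Ω - z • Ω‖ ≤ 1 * η := by gcongr
      _ = η := one_mul _

/-- Replacing `U Ω` by `u Ω` on both sides of the inner product produces the factor `|u|²`. That
this is nearly 1 is the same estimate applied to the identity operator. -/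
theorem norm_inner_conj_sub_le {Ω : H} (hΩ : ‖Ω‖ = 1) {U A : H →L[ℂ] H}
    (hU : U ∈ unitary (H →L[ℂ] H)) {ε : ℝ} (hε : ‖U Ω - (inner ℂ Ω (U Ω) : ℂ) • Ω‖ ≤ ε) :
    ‖(inner ℂ Ω ((star U * A * U) Ω) : ℂ) - inner ℂ Ω (A Ω)‖ ≤ 4 * ‖A‖ * ε := by
  set u : ℂ := inner ℂ Ω (U Ω)
  have hu : ‖u‖ ≤ 1 := norm_inner_unitary_le hΩ hU
  have hUΩ : ‖U Ω‖ = 1 := by rw [norm_apply_of_mem_unitary hU, hΩ]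
  have hε0 : 0 ≤ ε := (norm_nonneg _).trans hε
  have key : ∀ B : H →L[ℂ] H,
      ‖(inner ℂ (U Ω) (B (U Ω)) : ℂ) - u * (starRingEnd ℂ) u * inner ℂ Ω (B Ω)‖ ≤
        2 * ‖B‖ * ε := by
    intro B
    have e : (inner ℂ (U Ω) (B (U Ω)) : ℂ) - u * (starRingEnd ℂ) u * inner ℂ Ω (B Ω) =
        inner ℂ (U Ω) (B (U Ω - u • Ω)) + u * inner ℂ (U Ω - u • Ω) (B Ω) := by
      rw [map_sub, map_smul, inner_sub_right, inner_smul_right, inner_sub_left, inner_smul_left]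
      ring
    have hB : ‖B Ω‖ ≤ ‖B‖ := norm_apply_le_of_norm_one hΩ B
    have h1 : ‖(inner ℂ (U Ω) (B (U Ω - u • Ω)) : ℂ)‖ ≤ ‖B‖ * ε := by
      refine (norm_inner_le_norm _ _).trans ?_
      rw [hUΩ, one_mul]
      exact (B.le_opNorm _).trans (by gcongr)
    have h2 : ‖u * (inner ℂ (U Ω - u • Ω) (B Ω) : ℂ)‖ ≤ ‖B‖ * ε := by
      rw [norm_mul]
      have h3 := norm_inner_le_norm (𝕜 := ℂ) (U Ω - u • Ω) (B Ω)
      have h4 : ‖U Ω - u • Ω‖ * ‖B Ω‖ ≤ ε * ‖B‖ := by gcongr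
      calc ‖u‖ * ‖(inner ℂ (U Ω - u • Ω) (B Ω) : ℂ)‖ ≤ 1 * (ε * ‖B‖) := by
            gcongr; exact h3.trans h4
        _ = _ := by ring
    rw [e]
    refine (norm_add_le _ _).trans ?_
    linarith
  have e1 : (inner ℂ Ω ((star U * A * U) Ω) : ℂ) = inner ℂ (U Ω) (A (U Ω)) := by
    rw [ContinuousLinearMap.star_eq_adjoint]
    exact ContinuousLinearMap.adjoint_inner_right U Ω (A (U Ω))
  have hnt : ‖(1 : H →L[ℂ] H)‖ ≤ 1 := ContinuousLinearMap.norm_id_le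
  have h5 := key 1
  have h6 : ‖1 - u * (starRingEnd ℂ) u‖ ≤ 2 * ε := by
    simp only [one_apply_eq_self] at h5
    rw [inner_self_eq_norm_sq_to_K, inner_self_eq_norm_sq_to_K, hUΩ, hΩ] at h5
    simp only [RCLike.ofReal_one, one_pow, mul_one] at h5
    exact h5.trans (by nlinarith)
  have h7 : ‖(1 - u * (starRingEnd ℂ) u) * inner ℂ Ω (A Ω)‖ ≤ 2 * ε * ‖A‖ := by
    rw [norm_mul]
    gcongr
    exact norm_inner_apply_le hΩ A
  have e2 : (inner ℂ (U Ω) (A (U Ω)) : ℂ) - inner ℂ Ω (A Ω) =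
      (inner ℂ (U Ω) (A (U Ω)) - u * (starRingEnd ℂ) u * inner ℂ Ω (A Ω)) -
        (1 - u * (starRingEnd ℂ) u) * inner ℂ Ω (A Ω) := by ring
  rw [e1, e2]
  refine (norm_sub_le _ _).trans ?_
  linarith [key A]

theorem norm_exp_two_pi_sub_le (a b : ℝ) :
    ‖Complex.exp (2 * Real.pi * Complex.I * a) - Complex.exp (2 * Real.pi * Complex.I * b)‖ ≤
      2 * Real.pi * |a - b| := by
  have e : Complex.exp (2 * Real.pi * Complex.I * a) - Complex.exp (2 * Real.pi * Complex.I * b) =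
      Complex.exp (2 * Real.pi * Complex.I * b) *
        (Complex.exp (Complex.I * (2 * Real.pi * (a - b) : ℝ)) - 1) := by
    rw [mul_sub, ← Complex.exp_add, mul_one]
    congr 2
    push_cast
    ring
  have h1 : ‖Complex.exp (2 * Real.pi * Complex.I * b)‖ = 1 := by rw [Complex.norm_exp]; simp
  rw [e, norm_mul, h1, one_mul]
  refine (Real.norm_exp_I_mul_ofReal_sub_one_le).trans ?_
  rw [Real.norm_eq_abs, abs_mul, abs_of_pos (by positivity)]

/-- The data at a single parameter value: transport operators `Tm`, `Tp`, charge fluctuations `Km`,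
`Kp` with local approximations `Km'`, `Kp'` of their conjugates by `U`, and a clustering state `Ω`;
all norms are at most `M`, all errors at most `ε`, and correlations at most `κ`. -/
structure TransportData (Q : H →L[ℂ] H) (S S' : StarSubalgebra ℂ (H →L[ℂ] H))
    (U : H →L[ℂ] H) (Ω : H) (Tm Tp Km Kp Km' Kp' : H →L[ℂ] H) (M ε κ : ℝ) : Prop where
  splitting : ChargeSplitting Q S S'
  unitary : U ∈ unitary (H →L[ℂ] H)
  norm_state : ‖Ω‖ = 1
  mem_left : Tm ∈ S ∧ Km ∈ S ∧ Km' ∈ S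
  mem_right : Tp ∈ S' ∧ Kp ∈ S' ∧ Kp' ∈ S'
  selfAdjoint_left : IsSelfAdjoint Tm ∧ IsSelfAdjoint Km ∧ IsSelfAdjoint Km'
  selfAdjoint_right : IsSelfAdjoint Tp ∧ IsSelfAdjoint Kp ∧ IsSelfAdjoint Kp'
  norm_le : ‖Q‖ ≤ M ∧ ‖Tm‖ ≤ M ∧ ‖Tp‖ ≤ M ∧ ‖Km‖ ≤ M ∧ ‖Kp‖ ≤ M
  conservation : ‖(star U * Q * U - Q) - Tm - Tp‖ ≤ ε
  integrality : ‖expTwoPi (Q + Tm) - 1‖ ≤ ε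
  local_left : ‖star U * Km * U - Km'‖ ≤ ε
  local_right : ‖star U * Kp * U - Kp'‖ ≤ ε
  invariance : ‖U Ω - (inner ℂ Ω (U Ω) : ℂ) • Ω‖ ≤ ε
  fluctuation : ‖(Q - Km - Kp) Ω - (inner ℂ Ω ((Q - Km - Kp) Ω) : ℂ) • Ω‖ ≤ ε
  clustering : ∀ A ∈ S, ∀ B ∈ S',
    ‖(inner ℂ Ω ((A * B) Ω) : ℂ) - inner ℂ Ω (A Ω) * inner ℂ Ω (B Ω)‖ ≤ κ * ‖A‖ * ‖B‖

namespace TransportData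

variable {Q : H →L[ℂ] H} {S S' : StarSubalgebra ℂ (H →L[ℂ] H)} {U : H →L[ℂ] H} {Ω : H}
  {Tm Tp Km Kp Km' Kp' : H →L[ℂ] H} {M ε κ : ℝ}

theorem eps_nonneg (D : TransportData Q S S' U Ω Tm Tp Km Kp Km' Kp' M ε κ) : 0 ≤ ε :=
  (norm_nonneg _).trans D.invariance

theorem M_nonneg (D : TransportData Q S S' U Ω Tm Tp Km Kp Km' Kp' M ε κ) : 0 ≤ M :=
  (norm_nonneg _).trans D.norm_le.1

theorem norm_conj_le (D : TransportData Q S S' U Ω Tm Tp Km Kp Km' Kp' M ε κ) :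
    ‖Km'‖ ≤ M + ε ∧ ‖Kp'‖ ≤ M + ε := by
  have h1 := norm_sub_norm_le Km' (star U * Km * U)
  have h2 := norm_sub_norm_le Kp' (star U * Kp * U)
  rw [norm_conj_unitary_le D.unitary, norm_sub_rev] at h1 h2
  obtain ⟨-, -, -, h3, h4⟩ := D.norm_le
  constructor
  · linarith [D.local_left]
  · linarith [D.local_right]

/-- The dressed transport operator has `Ω` as approximate eigenvector. -/
theorem dressed_dispersion (hκ : 0 ≤ κ)
    (D : TransportData Q S S' U Ω Tm Tp Km Kp Km' Kp' M ε κ) :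
    ‖(Tm - Km' + Km) Ω - (inner ℂ Ω ((Tm - Km' + Km) Ω) : ℂ) • Ω‖ ≤
      √(4 * (3 * M + ε) * ((6 * M + 5) * ε) + κ * (3 * M + ε) * (3 * M + ε)) := by
  obtain ⟨hQn, hTmn, hTpn, hKmn, hKpn⟩ := D.norm_le
  obtain ⟨hKm'n, hKp'n⟩ := D.norm_conj_le
  have hε := D.eps_nonneg
  have hM := D.M_nonneg
  have hΩ := D.norm_state
  have hA : ‖Tm - Km' + Km‖ ≤ 3 * M + ε := by
    linarith [norm_add_le (Tm - Km') Km, norm_sub_le Tm Km']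
  have hB : ‖Tp - Kp' + Kp‖ ≤ 3 * M + ε := by
    linarith [norm_add_le (Tp - Kp') Kp, norm_sub_le Tp Kp']
  set R := Q - Km - Kp with hR
  have hRn : ‖R‖ ≤ 3 * M := by
    linarith [norm_sub_le (Q - Km) Kp, norm_sub_le Q Km]
  set r : ℂ := inner ℂ Ω (R Ω) with hr
  have hrn : ‖r‖ ≤ 3 * M := (norm_inner_apply_le hΩ R).trans hRn
  have h1 := norm_conj_apply_sub_le hΩ D.unitary D.invariance D.fluctuation
  -- The dressed operators sum to `U* R U - R` up to the conservation and localization errors. Both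
  -- terms act on `Ω` almost as the same scalar `r`, so the sum nearly annihilates `Ω`.
  have e : ((Tm - Km' + Km) + (Tp - Kp' + Kp)) Ω =
      ((star U * R * U) Ω - r • Ω) - (R Ω - r • Ω) +
        ((star U * Km * U - Km') + (star U * Kp * U - Kp') -
          ((star U * Q * U - Q) - Tm - Tp)) Ω := by
    have : star U * R * U = star U * Q * U - star U * Km * U - star U * Kp * U := by
      rw [hR]; noncomm_ring
    rw [this, hR]
    simp only [add_apply, sub_apply]
    abel
  have h2 : ‖((Tm - Km' + Km) + (Tp - Kp' + Kp)) Ω‖ ≤ (6 * M + 5) * ε := by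
    have h3 := (norm_apply_le_of_norm_one hΩ ((star U * Km * U - Km') +
      (star U * Kp * U - Kp') - ((star U * Q * U - Q) - Tm - Tp))).trans (norm_sub_le _ _)
    have h4 := norm_add_le (star U * Km * U - Km') (star U * Kp * U - Kp')
    have h5 : (‖R‖ + ‖r‖) * ε ≤ (6 * M) * ε := by gcongr; linarith
    rw [e]
    refine (norm_add_le _ _).trans ?_
    have h6 := norm_sub_le ((star U * R * U) Ω - r • Ω) (R Ω - r • Ω)
    have h7 := D.fluctuation
    have h8 := D.local_left
    have h9 := D.local_right
    have h10 := D.conservation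
    linarith
  have hsa : IsSelfAdjoint (Tm - Km' + Km) :=
    (D.selfAdjoint_left.1.sub D.selfAdjoint_left.2.2).add D.selfAdjoint_left.2.1
  have hmA : Tm - Km' + Km ∈ S := add_mem (sub_mem D.mem_left.1 D.mem_left.2.2) D.mem_left.2.1
  have hmB : Tp - Kp' + Kp ∈ S' :=
    add_mem (sub_mem D.mem_right.1 D.mem_right.2.2) D.mem_right.2.1
  refine Real.le_sqrt_of_sq_le
    ((norm_sub_sq_le_of_cov hΩ hsa h2 (D.clustering _ hmA _ hmB)).trans ?_)
  gcongr

end TransportData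

end Index

/-! ### Near-integrality of the expectation -/

section Index

variable {H : Type*} [NormedAddCommGroup H] [InnerProductSpace ℂ H] [CompleteSpace H]

namespace TransportData

variable {Q : H →L[ℂ] H} {S S' : StarSubalgebra ℂ (H →L[ℂ] H)} {U : H →L[ℂ] H} {Ω : H}
  {Tm Tp Km Kp Km' Kp' : H →L[ℂ] H} {M ε κ : ℝ}

/-- Integrality is assumed on the left only; it passes to the right because the two exponentials are
nearly inverse. -/
theorem norm_expTwoPi_right_sub_one_le
    (D : TransportData Q S S' U Ω Tm Tp Km Kp Km' Kp' M ε κ) :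
    ‖expTwoPi (Q + Tp) - 1‖ ≤ (2 * Real.pi + 1) * ε := by
  have hsa := D.splitting.isSelfAdjoint
  have h1 := norm_expTwoPi_sub_scalar_le D.splitting D.unitary D.mem_left.1 D.mem_right.1
    D.selfAdjoint_left.1 D.selfAdjoint_right.1
  have h2 : ‖(1 - expTwoPi (Q + Tm)) * expTwoPi (Q + Tp)‖ ≤ ε := by
    have hu : expTwoPi (Q + Tp) ∈ _root_.unitary (H →L[ℂ] H) :=
      expTwoPi_mem_unitary (hsa.add D.selfAdjoint_right.1)
    rw [CStarRing.norm_mul_mem_unitary _ hu, norm_sub_rev]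
    exact D.integrality
  have e : expTwoPi (Q + Tp) - 1 = (expTwoPi (Q + Tm) * expTwoPi (Q + Tp) - 1) +
      (1 - expTwoPi (Q + Tm)) * expTwoPi (Q + Tp) := by noncomm_ring
  rw [e]
  refine (norm_add_le _ _).trans ?_
  have h3 : 2 * Real.pi * ‖(star U * Q * U - Q) - Tm - Tp‖ ≤ 2 * Real.pi * ε := by
    gcongr; exact D.conservation
  linarith

/-- The exponential of the dressed charge at the left boundary is almost the conjugate of the
original one. -/
theorem norm_expTwoPi_sub_conj_le (D : TransportData Q S S' U Ω Tm Tp Km Kp Km' Kp' M ε κ) :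
    ‖expTwoPi (Q + (Tm - Km')) - star U * expTwoPi (Q + -Km) * U‖ ≤
      (6 * Real.pi + 1) * ε := by
  have hsa := D.splitting.isSelfAdjoint
  have hT : IsSelfAdjoint (Tm - Km') := D.selfAdjoint_left.1.sub D.selfAdjoint_left.2.2
  have h1 := D.splitting.expTwoPi_add _ (sub_mem D.mem_left.1 D.mem_left.2.2) _ D.mem_right.1
  have h2 : ‖expTwoPi (Q + (Tm - Km')) * (1 - expTwoPi (Q + Tp))‖ ≤ (2 * Real.pi + 1) * ε := by
    have hu : expTwoPi (Q + (Tm - Km')) ∈ _root_.unitary (H →L[ℂ] H) :=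
      expTwoPi_mem_unitary (hsa.add hT)
    rw [CStarRing.norm_mem_unitary_mul _ hu, norm_sub_rev]
    exact D.norm_expTwoPi_right_sub_one_le
  have h3 := norm_expTwoPi_sub_le (A := star U * (Q + -Km) * U) (B := Q + ((Tm - Km') + Tp))
    (isSelfAdjoint_star_mul_mul (hsa.add D.selfAdjoint_left.2.1.neg))
    (hsa.add (hT.add D.selfAdjoint_right.1))
  rw [expTwoPi_conj D.unitary, h1] at h3
  -- Adding `T₊` costs nothing under the exponential, and `Q + T₋ + T₊ - K₋' ≈ U* (Q - K₋) U` by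
  -- conservation and locality.
  have h4 : ‖Q + ((Tm - Km') + Tp) - star U * (Q + -Km) * U‖ ≤ 2 * ε := by
    have e : Q + ((Tm - Km') + Tp) - star U * (Q + -Km) * U =
        (star U * Km * U - Km') - ((star U * Q * U - Q) - Tm - Tp) := by noncomm_ring
    rw [e]
    linarith [norm_sub_le (star U * Km * U - Km') ((star U * Q * U - Q) - Tm - Tp),
      D.local_left, D.conservation]
  have h5 : 2 * Real.pi * ‖Q + ((Tm - Km') + Tp) - star U * (Q + -Km) * U‖ ≤
      2 * Real.pi * (2 * ε) := by gcongr
  have e : expTwoPi (Q + (Tm - Km')) - star U * expTwoPi (Q + -Km) * U =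
      expTwoPi (Q + (Tm - Km')) * (1 - expTwoPi (Q + Tp)) +
        (expTwoPi (Q + (Tm - Km')) * expTwoPi (Q + Tp) - star U * expTwoPi (Q + -Km) * U) := by
    noncomm_ring
  rw [e]
  refine (norm_add_le _ _).trans ?_
  linarith

/-- `K₋'` has almost the expectation of `U* K₋ U`, which is almost that of `K₋` because `U` nearly
fixes `Ω` up to a phase; so the dressing cancels in the mean. -/
theorem abs_dressed_sub_le (D : TransportData Q S S' U Ω Tm Tp Km Kp Km' Kp' M ε κ) :
    |(inner ℂ Ω ((Tm - Km' + Km) Ω) : ℂ).re - (inner ℂ Ω (Tm Ω) : ℂ).re| ≤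
      (4 * M + 1) * ε := by
  have hΩ := D.norm_state
  have h1 := norm_inner_conj_sub_le (A := Km) hΩ D.unitary D.invariance
  have h2 := (norm_inner_apply_le hΩ (star U * Km * U - Km')).trans D.local_left
  have e : (inner ℂ Ω ((Tm - Km' + Km) Ω) : ℂ) - inner ℂ Ω (Tm Ω) =
      inner ℂ Ω ((star U * Km * U - Km') Ω) -
        (inner ℂ Ω ((star U * Km * U) Ω) - inner ℂ Ω (Km Ω)) := by
    simp only [add_apply, sub_apply, inner_add_right, inner_sub_right]
    ring
  rw [← Complex.sub_re]
  refine (Complex.abs_re_le_norm _).trans ?_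
  rw [e]
  refine (norm_sub_le _ _).trans ?_
  have h3 : 4 * ‖Km‖ * ε ≤ 4 * M * ε := by
    have := D.eps_nonneg
    gcongr
    exact D.norm_le.2.2.2.1
  linarith

/-- The expectation of the transport operator is almost an integer. -/
theorem norm_exp_expectation_sub_one_le (hκ : 0 ≤ κ)
    (D : TransportData Q S S' U Ω Tm Tp Km Kp Km' Kp' M ε κ) :
    ‖Complex.exp (2 * Real.pi * Complex.I * (inner ℂ Ω (Tm Ω) : ℂ).re) - 1‖ ≤
      (2 * Real.pi * ε + κ) + 2 * √(2 * (2 * Real.pi * ε + κ)) + 2 * ε +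
      (6 * Real.pi + 1) * ε + 2 * Real.pi * (ε +
        √(4 * (3 * M + ε) * ((6 * M + 5) * ε) + κ * (3 * M + ε) * (3 * M + ε))) +
      2 * Real.pi * ((4 * M + 1) * ε) := by
  have hΩ := D.norm_state
  have hsa := D.splitting.isSelfAdjoint
  have hdis := D.dressed_dispersion hκ
  set e₂ := √(4 * (3 * M + ε) * ((6 * M + 5) * ε) + κ * (3 * M + ε) * (3 * M + ε))
  set R := Q - Km - Kp with hR
  have hRsa : IsSelfAdjoint R := (hsa.sub D.selfAdjoint_left.2.1).sub D.selfAdjoint_right.2.1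
  set T := Tm - Km' + Km with hT
  have hTsa : IsSelfAdjoint T :=
    (D.selfAdjoint_left.1.sub D.selfAdjoint_left.2.2).add D.selfAdjoint_left.2.1
  set q : ℝ := (inner ℂ Ω (R Ω) : ℂ).re with hq
  set τ : ℝ := (inner ℂ Ω (T Ω) : ℂ).re with hτ
  have hqc : (q : ℂ) = inner ℂ Ω (R Ω) := ofReal_re_inner_of_isSelfAdjoint hRsa Ω
  have hτc : (τ : ℂ) = inner ℂ Ω (T Ω) := ofReal_re_inner_of_isSelfAdjoint hTsa Ω
  -- `W` is nearly the conjugate of `Z` by `U`. The product with `Z'` is evaluated on `Ω` for both: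
  -- `Z Z'` carries the phase of `R`, and `W Z'` that of `R + T`.
  set Z := expTwoPi (Q + -Km) with hZ
  set Z' := expTwoPi (Q + -Kp) with hZ'
  set W := expTwoPi (Q + (Tm - Km')) with hW
  have hZm : Z ∈ S := D.splitting.mem_left _ (neg_mem D.mem_left.2.1)
  have hZ'm : Z' ∈ S' := D.splitting.mem_right _ (neg_mem D.mem_right.2.1)
  have hZu : Z ∈ _root_.unitary (H →L[ℂ] H) :=
    expTwoPi_mem_unitary (hsa.add D.selfAdjoint_left.2.1.neg)
  have hZ'u : Z' ∈ _root_.unitary (H →L[ℂ] H) :=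
    expTwoPi_mem_unitary (hsa.add D.selfAdjoint_right.2.1.neg)
  have hnorm : ∀ x : ℝ, ‖Complex.exp (2 * Real.pi * Complex.I * x)‖ = 1 := fun x => by
    rw [Complex.norm_exp]; simp
  set w : ℂ := Complex.exp (2 * Real.pi * Complex.I * q) with hw
  have hZZ' : Z * Z' = expTwoPi R := by
    rw [hZ, hZ', ← D.splitting.expTwoPi_add _ (neg_mem D.mem_left.2.1) _
      (neg_mem D.mem_right.2.1), hR]
    congr 1; abel
  have h1 : ‖(Z * Z') Ω - w • Ω‖ ≤ 2 * Real.pi * ε := by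
    rw [hZZ']
    refine (norm_expTwoPi_apply_sub_le hRsa q Ω).trans ?_
    rw [hqc]
    gcongr
    exact D.fluctuation
  have hone : ∀ V ∈ _root_.unitary (H →L[ℂ] H), ‖V‖ ≤ 1 := fun V hV =>
    ContinuousLinearMap.opNorm_le_bound _ zero_le_one fun x => by
      rw [norm_apply_of_mem_unitary hV, one_mul]
  have h2 : ‖(inner ℂ Ω ((Z * Z') Ω) : ℂ) - inner ℂ Ω (Z Ω) * inner ℂ Ω (Z' Ω)‖ ≤ κ := by
    refine (D.clustering _ hZm _ hZ'm).trans ?_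
    calc κ * ‖Z‖ * ‖Z'‖ ≤ κ * 1 * 1 := by gcongr <;> [exact hone Z hZu; exact hone Z' hZ'u]
      _ = κ := by ring
  obtain ⟨h3, h4, h5⟩ := unitary_dispersion_of_cov hΩ hZu hZ'u (hnorm q) h1 h2
  set z : ℂ := inner ℂ Ω (Z Ω) with hz
  set z' : ℂ := inner ℂ Ω (Z' Ω) with hz'
  set e₃ := 2 * Real.pi * ε + κ
  have h6 : ‖Z Ω - z • Ω‖ ≤ √(2 * e₃) := Real.le_sqrt_of_sq_le h4
  have h7 : ‖Z' Ω - z' • Ω‖ ≤ √(2 * e₃) := Real.le_sqrt_of_sq_le h5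
  have hz1 : ‖z‖ ≤ 1 := norm_inner_unitary_le hΩ hZu
  have hz'1 : ‖z'‖ ≤ 1 := norm_inner_unitary_le hΩ hZ'u
  have h8 : ‖(star U * Z * U) Ω - z • Ω‖ ≤ 2 * ε + √(2 * e₃) := by
    refine (norm_conj_apply_sub_le hΩ D.unitary D.invariance h6).trans ?_
    have := D.eps_nonneg
    have h9 : (‖Z‖ + ‖z‖) * ε ≤ 2 * ε := by
      gcongr; linarith [hone Z hZu]
    linarith
  have hCu : star U * Z * U ∈ _root_.unitary (H →L[ℂ] H) :=
    mul_mem (mul_mem (Unitary.star_mem D.unitary) hZu) D.unitary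
  -- `Z'` and then the conjugate of `Z` act on `Ω` almost as scalars, since `U` preserves the
  -- approximate eigenvector property.
  have h9 : ‖(star U * Z * U) (Z' Ω) - (z * z') • Ω‖ ≤ 2 * ε + 2 * √(2 * e₃) := by
    have e : (star U * Z * U) (Z' Ω) - (z * z') • Ω =
        (star U * Z * U) (Z' Ω - z' • Ω) + z' • ((star U * Z * U) Ω - z • Ω) := by
      rw [map_sub, map_smul, smul_sub, smul_smul, mul_comm z z']; abel
    rw [e]
    refine (norm_add_le _ _).trans ?_
    rw [norm_apply_of_mem_unitary hCu, norm_smul]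
    have h10 : ‖z'‖ * ‖(star U * Z * U) Ω - z • Ω‖ ≤ 1 * (2 * ε + √(2 * e₃)) := by gcongr
    linarith
  have h10 : ‖W (Z' Ω) - (star U * Z * U) (Z' Ω)‖ ≤ (6 * Real.pi + 1) * ε := by
    rw [← sub_apply]
    refine (ContinuousLinearMap.le_opNorm _ _).trans ?_
    rw [norm_apply_of_mem_unitary hZ'u, hΩ, mul_one]
    exact D.norm_expTwoPi_sub_conj_le
  have hWZ' : W * Z' = expTwoPi (R + T) := by
    rw [hW, hZ', ← D.splitting.expTwoPi_add _ (sub_mem D.mem_left.1 D.mem_left.2.2) _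
      (neg_mem D.mem_right.2.1), hR, hT]
    congr 1; abel
  have h11 : ‖W (Z' Ω) - Complex.exp (2 * Real.pi * Complex.I * (q + τ : ℝ)) • Ω‖ ≤
      2 * Real.pi * (ε + e₂) := by
    rw [← mul_apply_eq_comp, hWZ']
    refine (norm_expTwoPi_apply_sub_le (hRsa.add hTsa) (q + τ) Ω).trans ?_
    gcongr
    have e : (R + T) Ω - ((q + τ : ℝ) : ℂ) • Ω = (R Ω - (q : ℂ) • Ω) + (T Ω - (τ : ℂ) • Ω) := by
      rw [add_apply, Complex.ofReal_add, add_smul]; abel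
    rw [e]
    refine (norm_add_le _ _).trans (add_le_add ?_ ?_)
    · rw [hqc]; exact D.fluctuation
    · rw [hτc]; exact hdis
  set w' : ℂ := Complex.exp (2 * Real.pi * Complex.I * (q + τ : ℝ)) with hw'
  -- Two evaluations of `W Z' Ω` are compared, and `‖Ω‖ = 1` turns this into a comparison of phases.
  have h12 : ‖w' - z * z'‖ ≤ 2 * Real.pi * (ε + e₂) + (6 * Real.pi + 1) * ε +
      (2 * ε + 2 * √(2 * e₃)) := by
    have e : ‖w' - z * z'‖ = ‖w' • Ω - (z * z') • Ω‖ := by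
      rw [← sub_smul, norm_smul, hΩ, mul_one]
    rw [e]
    have h13 := norm_sub_le_norm_sub_add_norm_sub (w' • Ω) (W (Z' Ω)) ((z * z') • Ω)
    have h14 := norm_sub_le_norm_sub_add_norm_sub (W (Z' Ω)) ((star U * Z * U) (Z' Ω))
      ((z * z') • Ω)
    rw [norm_sub_rev (w' • Ω) (W (Z' Ω))] at h13
    linarith
  have h13 : ‖Complex.exp (2 * Real.pi * Complex.I * τ) - 1‖ ≤
      2 * Real.pi * (ε + e₂) + (6 * Real.pi + 1) * ε + (2 * ε + 2 * √(2 * e₃)) + e₃ := by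
    have e : w' - w = w * (Complex.exp (2 * Real.pi * Complex.I * τ) - 1) := by
      rw [hw', hw, mul_sub, ← Complex.exp_add, mul_one]
      congr 2
      push_cast
      ring
    have e2 : ‖Complex.exp (2 * Real.pi * Complex.I * τ) - 1‖ = ‖w' - w‖ := by
      rw [e, norm_mul, hnorm q, one_mul]
    rw [e2]
    linarith [norm_sub_le_norm_sub_add_norm_sub w' (z * z') w]
  have h14 := norm_exp_two_pi_sub_le (inner ℂ Ω (Tm Ω) : ℂ).re τ
  have h15 : 2 * Real.pi * |(inner ℂ Ω (Tm Ω) : ℂ).re - τ| ≤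
      2 * Real.pi * ((4 * M + 1) * ε) := by
    gcongr
    rw [abs_sub_comm]
    exact D.abs_dressed_sub_le
  have h16 := norm_sub_le_norm_sub_add_norm_sub
    (Complex.exp (2 * Real.pi * Complex.I * (inner ℂ Ω (Tm Ω) : ℂ).re))
    (Complex.exp (2 * Real.pi * Complex.I * τ)) 1
  linarith

end TransportData

/-- Distance of a real number to the nearest integer, from the associated phase. -/
theorem abs_sub_round_le (t : ℝ) :
    |t - round t| ≤ ‖Complex.exp (2 * Real.pi * Complex.I * t) - 1‖ := by
  set x := t - round t with hx
  have hx2 : |x| ≤ 1 / 2 := abs_sub_round t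
  have e : Complex.exp (2 * Real.pi * Complex.I * t) =
      Complex.exp (Complex.I * (2 * Real.pi * x : ℝ)) := by
    have : (2 * Real.pi * Complex.I * t : ℂ) =
        Complex.I * (2 * Real.pi * x : ℝ) + (round t : ℤ) * (2 * Real.pi * Complex.I) := by
      rw [hx]; push_cast; ring
    rw [this, Complex.exp_add, Complex.exp_int_mul_two_pi_mul_I, mul_one]
  have h1 : |Real.pi * x| ≤ Real.pi / 2 := by
    rw [abs_mul, abs_of_pos Real.pi_pos]
    nlinarith [Real.pi_pos]
  -- Jordan's inequality: `|exp(2πix) - 1| = 2|sin πx| ≥ 4|x|` for `|x| ≤ 1/2`, more than is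
  -- claimed.
  have h2 := Real.mul_abs_le_abs_sin h1
  rw [e, Complex.norm_exp_I_mul_ofReal_sub_one, Real.norm_eq_abs, abs_mul,
    show 2 * Real.pi * x / 2 = Real.pi * x by ring]
  rw [abs_mul, abs_of_pos Real.pi_pos, ← mul_assoc, div_mul_cancel₀ _ Real.pi_ne_zero] at h2
  have h3 : |(2 : ℝ)| = 2 := abs_of_pos two_pos
  rw [h3]
  linarith [abs_nonneg x]

/-- A continuous function on an interval whose values are close to integers is close to a single
integer. -/
theorem exists_int_of_continuousOn {t : ℝ → ℝ} {a b : ℝ} (hab : a ≤ b)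
    (ht : ContinuousOn t (Icc a b)) (h : ∀ s ∈ Icc a b, |t s - round (t s)| < 1 / 4) :
    ∃ m : ℤ, ∀ s ∈ Icc a b, round (t s) = m := by
  refine ⟨round (t a), fun s hs => ?_⟩
  have ha : a ∈ Icc a b := left_mem_Icc.2 hab
  by_contra hne
  have hconn : OrdConnected (t '' Icc a b) := (isPreconnected_Icc.image t ht).ordConnected
  have key : ∀ x ∈ Icc a b, ∀ y ∈ Icc a b, ¬ round (t x) < round (t y) := by
    intro x hx y hy hlt
    have h1 := abs_lt.1 (h x hx)
    have h2 := abs_lt.1 (h y hy)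
    have h3 : ((round (t x) : ℤ) : ℝ) + 1 ≤ round (t y) := by exact_mod_cast hlt
    -- If the nearest integer increased, the value `round (t x) + 1/2` would be attained, and this
    -- is not within 1/4 of an integer.
    obtain ⟨v, hv, hve⟩ := hconn.out (mem_image_of_mem t hx) (mem_image_of_mem t hy)
      (show ((round (t x) : ℤ) : ℝ) + 1 / 2 ∈ Icc (t x) (t y) by
        constructor <;> linarith)
    have h4 := abs_lt.1 (h v hv)
    rw [hve] at h4
    have h5 : ((round (t x) : ℤ) : ℝ) < (round (((round (t x) : ℤ) : ℝ) + 1 / 2) : ℤ) := by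
      linarith
    have h6 : ((round (((round (t x) : ℤ) : ℝ) + 1 / 2) : ℤ) : ℝ) <
        ((round (t x) + 1 : ℤ) : ℝ) := by
      push_cast; linarith
    have h7 := Int.cast_lt.1 h5
    have h8 := Int.cast_lt.1 h6
    omega
  rcases lt_or_gt_of_ne hne with h' | h'
  · exact key s hs a ha h'
  · exact key a ha s hs h'

end Index

/-- Almost locality supplies approximants that need not be self-adjoint; passing to the self-adjoint
part stays in `S` and brings them no further from `X`. -/
theorem exists_selfAdjoint_approx {H : Type*} [NormedAddCommGroup H] [InnerProductSpace ℂ H]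
    [CompleteSpace H] {S : StarSubalgebra ℂ (H →L[ℂ] H)} {X R : H →L[ℂ] H}
    (hX : IsSelfAdjoint X) (hR : R ∈ S) : ∃ R' ∈ S, IsSelfAdjoint R' ∧ ‖X - R'‖ ≤ ‖X - R‖ := by
  refine ⟨(1 / 2 : ℂ) • (R + star R), S.smul_mem (add_mem hR (star_mem hR)) _, ?_, ?_⟩
  · rw [IsSelfAdjoint, star_smul, star_add, star_star, add_comm]
    simp
  · have e : X - (1 / 2 : ℂ) • (R + star R) = (1 / 2 : ℂ) • ((X - R) + star (X - R)) := by
      rw [star_sub, hX.star_eq]; module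
    have h := norm_add_le (X - R) (star (X - R))
    rw [norm_star] at h
    rw [e, norm_smul]
    simp only [one_div, norm_inv, Complex.norm_ofNat]
    linarith

theorem RapidDecay.exists_bound {f : ℕ → ℝ} (hf : RapidDecay f) : ∃ C, 0 ≤ C ∧ ∀ m, f m ≤ C := by
  have h := hf 0
  simp only [pow_zero, one_mul] at h
  obtain ⟨C, hC⟩ := h.bddAbove_range
  exact ⟨max C 0, le_max_right _ _, fun m => (hC ⟨m, rfl⟩).trans (le_max_left _ _)⟩

/-! ### Uniform estimates in `L` and `s` -/

section Families

variable {st : Statistics} {d n : ℕ} [NeZero d]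
  {Q : (L : EvenSide) → Site d L → Op st d n L} {U : (L : EvenSide) → ℝ → Op st d n L}
  {Ω : (L : EvenSide) → ℝ → Hilb st d n L}

theorem LocalCharges.chargeSplitting (hQ : LocalCharges Q) (L : EvenSide) :
    ChargeSplitting (halfCharge (Q L)) (localStarAlg st d n L (Site.stripMinus d L))
      (localStarAlg st d n L (Site.stripPlus d L)) :=
  chargeSplitting_halfCharge (hQ.selfAdjoint L) (hQ.onSite L) (hQ.spectrum_int L)
    Site.disjoint_strips

/-- Existence of admissible transport operators, continuous in the parameter. -/
theorem exists_admissible_continuous (hQ : LocalCharges Q) (hUΩ : UniformAssumptions Q U Ω)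
    (hU : ∀ L, ContinuousOn (U L) (Icc (-1) 1)) :
    ∃ Tm Tp : (L : EvenSide) → ℝ → Op st d n L,
      AdmissibleTransport Q U Tm Tp ∧ ∀ L, ContinuousOn (Tm L) (Icc (-1) 1) := by
  obtain ⟨f, hf, hcons⟩ := hUΩ.charge_conservation
  have key : ∀ L : EvenSide, _ := fun L => by
    have : Nontrivial (Hilb st d n L) :=
      ⟨Ω L 0, 0, fun h => by simpa [h] using hUΩ.norm_state L 0 (by simp)⟩
    -- The margin for continuity is taken as `exp(-L)`, strictly positive and rapidly decaying.
    exact exists_continuousOn_transport (hQ.chargeSplitting L)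
      (fun s hs => (hUΩ.unitary_mem L s hs).1) (hU L) (ε := f L)
      (Real.exp_pos (-1 * (L : ℝ))) (fun s hs => by
        obtain ⟨A, hA, B, hB, h1, h2, h3⟩ := hcons L s hs
        exact ⟨A, mem_localStarAlg.2 hA, B, mem_localStarAlg.2 hB, h1, h2, h3⟩)
  choose Tm Tp hcont hprop using key
  have hdec : RapidDecay fun m => f m + Real.exp (-1 * (m : ℝ)) := hf.add (rapidDecay_exp one_pos)
  obtain ⟨C, hC⟩ := hQ.norm_le
  obtain ⟨C₀, hC₀, hfC⟩ := hf.exists_bound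
  have hbound : ∀ L : EvenSide, 7 * ‖halfCharge (Q L)‖ + 3 * f L ≤
      (7 * C + 3 * C₀) * (L : ℝ) ^ d := fun L => by
    have h1 : (1 : ℝ) ≤ (L : ℝ) ^ d := one_le_pow₀ (by exact_mod_cast L.2.1)
    have h2 : C₀ ≤ C₀ * (L : ℝ) ^ d := le_mul_of_one_le_right hC₀ h1
    linarith [hC L, hfC L]
  refine ⟨Tm, Tp, ⟨fun L s hs => (hprop L s hs).1, fun L s hs => ?_,
    ⟨_, hdec, fun L s hs => (hprop L s hs).2.2.1⟩,
    ⟨_, hdec.const_mul (4 * Real.pi), fun L s hs => (hprop L s hs).2.2.2.1⟩,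
    ⟨_, fun L s hs => ⟨(hprop L s hs).2.2.2.2.1.trans (hbound L),
      (hprop L s hs).2.2.2.2.2.trans (hbound L)⟩⟩⟩, hcont⟩
  exact ⟨mem_localStarAlg.1 (hprop L s hs).2.1.1, mem_localStarAlg.1 (hprop L s hs).2.1.2⟩

/-- Admissible transport operators provide the data of the index estimate, with errors of order
`O(L^{-∞})`. -/
theorem exists_transportData (hQ : LocalCharges Q) (hUΩ : UniformAssumptions Q U Ω)
    {Tm Tp : (L : EvenSide) → ℝ → Op st d n L} (hT : AdmissibleTransport Q U Tm Tp) :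
    ∃ M ε κ : ℕ → ℝ, (∃ C, ∀ m, M m = C * (m : ℝ) ^ d) ∧ RapidDecay ε ∧ RapidDecay κ ∧
      (∀ m, 0 ≤ κ m) ∧ ∀ L : EvenSide, 64 ≤ (L : ℕ) → ∀ s ∈ Icc (-1 : ℝ) 1,
      ∃ Km Kp Km' Kp', TransportData (halfCharge (Q L))
        (localStarAlg st d n L (Site.stripMinus d L)) (localStarAlg st d n L (Site.stripPlus d L))
        (U L s) (Ω L s) (Tm L s) (Tp L s) Km Kp Km' Kp' (M L) (ε L) (κ L) := by
  obtain ⟨C₁, hC₁⟩ := hQ.norm_le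
  obtain ⟨C₂, hC₂⟩ := hT.norm_le
  obtain ⟨f₁, hf₁, hsplit⟩ := hT.splitting
  obtain ⟨f₂, hf₂, hint⟩ := hT.integrality
  obtain ⟨f₃, hf₃, hloc⟩ := hUΩ.almost_local
  obtain ⟨f₄, hf₄, hinv⟩ := hUΩ.invariance
  obtain ⟨f₅, C₃, hf₅, hfluc⟩ := hUΩ.charge_fluctuations
  obtain ⟨C₄, c, hC₄, hc, hclus⟩ := hUΩ.clustering
  set C := max C₁ (max C₂ C₃) with hC
  have hle₁ : C₁ ≤ C := le_max_left _ _
  have hle₂ : C₂ ≤ C := (le_max_left _ _).trans (le_max_right _ _)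
  have hle₃ : C₃ ≤ C := (le_max_right _ _).trans (le_max_right _ _)
  -- Errors of splitting, integrality, invariance and fluctuations (square roots, as a variance is a
  -- squared norm), then almost locality at radius `L/32`, where `‖K‖ |X| ≤ |C| L^{2d}`.
  let ε : ℕ → ℝ := fun m => |f₁ m| + |f₂ m| + √(f₄ m) + √(f₅ m) +
    |f₃ (m / 32)| * (m : ℝ) ^ (d + d) * |C|
  -- The strips are at distance at least `L/4`, and each cardinality is at most `L^d`.
  let κ : ℕ → ℝ := fun m => Real.exp (-(c / 4) * m) * (m : ℝ) ^ (d + d) * C₄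
  have hε : RapidDecay ε := (((hf₁.abs.add hf₂.abs).add hf₄.sqrt).add hf₅.sqrt).add
    (((hf₃.abs.comp_div (by norm_num : 0 < 32)).mul_param_pow (d + d)).mul_const |C|)
  have hκ : RapidDecay κ :=
    ((rapidDecay_exp (by positivity : 0 < c / 4)).mul_param_pow (d + d)).mul_const C₄
  refine ⟨fun m => C * (m : ℝ) ^ d, ε, κ, ⟨C, fun m => rfl⟩, hε, hκ,
    fun m => by positivity, fun L hL s hs => ?_⟩
  have hp₁ : 0 ≤ |f₁ L| := abs_nonneg _
  have hp₂ : 0 ≤ |f₂ L| := abs_nonneg _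
  have hp₄ : 0 ≤ √(f₄ L) := Real.sqrt_nonneg _
  have hp₅ : 0 ≤ √(f₅ L) := Real.sqrt_nonneg _
  have hp₃ : 0 ≤ |f₃ ((L : ℕ) / 32)| * (L : ℝ) ^ (d + d) * |C| := by positivity
  have hεL : ε L = |f₁ L| + |f₂ L| + √(f₄ L) + √(f₅ L) +
    |f₃ ((L : ℕ) / 32)| * (L : ℝ) ^ (d + d) * |C| := rfl
  obtain ⟨Km, hKm, Kp, hKp, hKmsa, hKpsa, hKmn, hKpn, hvar⟩ := hfluc L s hs
  have hpow : ∀ {a : ℝ}, a ≤ C → a * (L : ℝ) ^ d ≤ C * (L : ℝ) ^ d := fun h => by gcongr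
  have hUu := (hUΩ.unitary_mem L s hs).1
  have happrox : ∀ (X Y : Finset (Site d L)) (K : Op st d n L), K ∈ localAlg st d n L X →
      IsSelfAdjoint K → ‖K‖ ≤ C₃ * (L : ℝ) ^ d → Site.fatten X ((L : ℕ) / 32) ⊆ Y →
      K ∈ localStarAlg st d n L Y ∧ ∃ K' ∈ localStarAlg st d n L Y, IsSelfAdjoint K' ∧
        ‖star (U L s) * K * U L s - K'‖ ≤ ε L := by
    intro X Y K hK hKsa hKn hXY
    refine ⟨localStarAlg_mono ((Site.subset_fatten X _).trans hXY) (mem_localStarAlg.2 hK), ?_⟩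
    obtain ⟨R, hR, hRn⟩ := hloc L s hs X K hK ((L : ℕ) / 32)
    obtain ⟨R', hR', hRsa, hRle⟩ := exists_selfAdjoint_approx
      (isSelfAdjoint_star_mul_mul (U := U L s) hKsa) (mem_localStarAlg.2 hR)
    refine ⟨R', localStarAlg_mono hXY hR', hRsa, hRle.trans (hRn.trans ?_)⟩
    have h1 : ‖K‖ * X.card ≤ (|C| * (L : ℝ) ^ d) * (L : ℝ) ^ d := by
      refine mul_le_mul ?_ (Site.card_le X) (by positivity) (by positivity)
      exact (hKn.trans (hpow hle₃)).trans (by gcongr; exact le_abs_self _)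
    calc f₃ ((L : ℕ) / 32) * (‖K‖ * X.card) ≤
          |f₃ ((L : ℕ) / 32)| * ((|C| * (L : ℝ) ^ d) * (L : ℝ) ^ d) := by
          refine mul_le_mul (le_abs_self _) h1 (by positivity) (abs_nonneg _)
      _ = |f₃ ((L : ℕ) / 32)| * (L : ℝ) ^ (d + d) * |C| := by rw [pow_add]; ring
      _ ≤ ε L := by rw [hεL]; linarith
  obtain ⟨hKmS, Km', hKm', hKm'sa, hKm'n⟩ := happrox _ (Site.stripMinus d L) Km hKm hKmsa hKmn
    (Site.fatten_fatten_bdryMinus_subset d L)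
  obtain ⟨hKpS, Kp', hKp', hKp'sa, hKp'n⟩ := happrox _ (Site.stripPlus d L) Kp hKp hKpsa hKpn
    (Site.fatten_fatten_bdryPlus_subset d L hL)
  refine ⟨Km, Kp, Km', Kp', ?_⟩
  exact {
    splitting := hQ.chargeSplitting L
    unitary := hUu
    norm_state := hUΩ.norm_state L s hs
    mem_left := ⟨mem_localStarAlg.2 (hT.supported L s hs).1, hKmS, hKm'⟩
    mem_right := ⟨mem_localStarAlg.2 (hT.supported L s hs).2, hKpS, hKp'⟩
    selfAdjoint_left := ⟨(hT.selfAdjoint L s hs).1, hKmsa, hKm'sa⟩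
    selfAdjoint_right := ⟨(hT.selfAdjoint L s hs).2, hKpsa, hKp'sa⟩
    norm_le := ⟨(hC₁ L).trans (hpow hle₁), (hC₂ L s hs).1.trans (hpow hle₂),
      (hC₂ L s hs).2.trans (hpow hle₂), hKmn.trans (hpow hle₃), hKpn.trans (hpow hle₃)⟩
    conservation := (hsplit L s hs).trans (by rw [hεL]; linarith [le_abs_self (f₁ L)])
    integrality := (hint L s hs).trans (by rw [hεL]; linarith [le_abs_self (f₂ L)])
    local_left := hKm'n
    local_right := hKp'n
    invariance := (Real.le_sqrt_of_sq_le (hinv L s hs)).trans (by rw [hεL]; linarith)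
    fluctuation := (Real.le_sqrt_of_sq_le hvar).trans (by rw [hεL]; linarith)
    clustering := fun A hA B hB => by
      refine (hclus L s hs _ _ A (mem_localStarAlg.1 hA) B (mem_localStarAlg.1 hB)).trans ?_
      have h1 : Real.exp (-c * Site.d1 (Site.stripMinus d L) (Site.stripPlus d L)) ≤
          Real.exp (-(c / 4) * (L : ℝ)) := by
        refine Real.exp_le_exp.2 ?_
        have h2 : ((L : ℕ) : ℝ) ≤ 4 * (Site.d1 (Site.stripMinus d L) (Site.stripPlus d L) : ℝ) := by
          exact_mod_cast Site.le_d1_strips (d := d) (L := L)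
        nlinarith
      calc _ ≤ C₄ * ‖A‖ * ‖B‖ * (L : ℝ) ^ d * (L : ℝ) ^ d * Real.exp (-(c / 4) * (L : ℝ)) := by
            gcongr
            · exact Site.card_le _
            · exact Site.card_le _
        _ = κ L * ‖A‖ * ‖B‖ := by simp only [κ, pow_add]; ring }

/-- The expectations of admissible transport operators are integers up to `O(L^{-∞})`. -/
theorem exists_expectation_near_int (hQ : LocalCharges Q) (hUΩ : UniformAssumptions Q U Ω)
    {Tm Tp : (L : EvenSide) → ℝ → Op st d n L} (hT : AdmissibleTransport Q U Tm Tp) :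
    ∃ g : ℕ → ℝ, RapidDecay g ∧ ∀ L : EvenSide, 64 ≤ (L : ℕ) → ∀ s ∈ Icc (-1 : ℝ) 1,
      |(expVal (Ω L s) (Tm L s)).re - round (expVal (Ω L s) (Tm L s)).re| ≤ g L := by
  obtain ⟨M, ε, κ, ⟨C, hM⟩, hε, hκ, hκ0, hD⟩ := exists_transportData hQ hUΩ hT
  let ℓ : EvenSide → ℕ := fun L => L
  have hℓ : ∀ L, 0 < ℓ L := fun L => L.2.1
  -- Nonnegativity of `ε` and `M` comes from the data, available only for `64 ≤ L`. Absolute values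
  -- make the estimates valid for all `L` and are removed at the end.
  have uε : UniformDecay ℓ fun L => |ε L| := ⟨_, hε.abs, fun L => le_rfl⟩
  have uκ : UniformDecay ℓ fun L => κ L := ⟨_, hκ, fun L => le_rfl⟩
  have pM : PolyBounded ℓ fun L => |M L| := ⟨|C|, d, fun L => by
    simp only [hM, abs_mul, abs_pow, Nat.abs_cast]; rfl⟩
  have cst : ∀ c : ℝ, PolyBounded ℓ fun _ => c := polyBounded_const
  have p3 : PolyBounded ℓ fun L => 3 * |M L| + |ε L| :=
    ((cst 3).mul pM fun _ => abs_nonneg _).add hℓ uε.polyBounded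
  have p6 : PolyBounded ℓ fun L => 6 * |M L| + 5 :=
    ((cst 6).mul pM fun _ => abs_nonneg _).add hℓ (cst 5)
  have p4 : PolyBounded ℓ fun L => 4 * |M L| + 1 :=
    ((cst 4).mul pM fun _ => abs_nonneg _).add hℓ (cst 1)
  have n3 : ∀ L : EvenSide, 0 ≤ 3 * |M L| + |ε L| := fun L => by positivity
  have n6 : ∀ L : EvenSide, 0 ≤ 6 * |M L| + 5 := fun L => by positivity
  have n4 : ∀ L : EvenSide, 0 ≤ 4 * |M L| + 1 := fun L => by positivity
  have ue3 : UniformDecay ℓ fun L => 2 * Real.pi * |ε L| + κ L :=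
    (uε.const_mul (by positivity)).add uκ
  have us : UniformDecay ℓ fun L => √(4 * (3 * |M L| + |ε L|) * ((6 * |M L| + 5) * |ε L|) +
      κ L * (3 * |M L| + |ε L|) * (3 * |M L| + |ε L|)) := by
    refine UniformDecay.sqrt (UniformDecay.add ?_ ((uκ.mul_poly p3 n3).mul_poly p3 n3))
    exact (((uε.mul_poly p6 n6).mul_poly p3 n3).const_mul (by norm_num : (0 : ℝ) ≤ 4)).mono
      fun L => le_of_eq (by ring)
  have utot : UniformDecay ℓ fun L =>
      (2 * Real.pi * |ε L| + κ L) + 2 * √(2 * (2 * Real.pi * |ε L| + κ L)) + 2 * |ε L| +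
      (6 * Real.pi + 1) * |ε L| + 2 * Real.pi * (|ε L| +
        √(4 * (3 * |M L| + |ε L|) * ((6 * |M L| + 5) * |ε L|) +
          κ L * (3 * |M L| + |ε L|) * (3 * |M L| + |ε L|))) +
      2 * Real.pi * ((4 * |M L| + 1) * |ε L|) := by
    refine ((((ue3.add ((ue3.const_mul zero_le_two).sqrt.const_mul zero_le_two)).add
      (uε.const_mul zero_le_two)).add (uε.const_mul (by positivity))).add
      ((uε.add us).const_mul (by positivity))).add ?_
    exact ((uε.mul_poly p4 n4).const_mul (by positivity : 0 ≤ 2 * Real.pi)).mono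
      fun L => le_of_eq (by ring)
  obtain ⟨g, hg, hgle⟩ := utot
  refine ⟨g, hg, fun L hL s hs => ?_⟩
  obtain ⟨Km, Kp, Km', Kp', D⟩ := hD L hL s hs
  have h1 := D.norm_exp_expectation_sub_one_le (hκ0 L)
  have h2 := hgle L
  simp only [abs_of_nonneg D.eps_nonneg, abs_of_nonneg D.M_nonneg] at h2
  exact ((abs_sub_round_le _).trans h1).trans h2

end Families

end

/-! ### The proposition -/

theorem mainTheorem3 {st : Statistics} {d n : ℕ} [NeZero d]
    (Q : (L : EvenSide) → Site d L → Op st d n L)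
    (U : (L : EvenSide) → ℝ → Op st d n L)
    (Ω : (L : EvenSide) → ℝ → Hilb st d n L)
    (hQ : LocalCharges Q)
    (hUΩ : UniformAssumptions Q U Ω)
    (hU : ∀ L, ContinuousOn (U L) (Icc (-1) 1))
    (hΩ : ∀ L, ContinuousOn (Ω L) (Icc (-1) 1)) :
    (∃ Tm Tp : (L : EvenSide) → ℝ → Op st d n L,
      AdmissibleTransport Q U Tm Tp ∧ ∀ L, ContinuousOn (Tm L) (Icc (-1) 1)) ∧
    (∀ Tm Tp : (L : EvenSide) → ℝ → Op st d n L,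
      AdmissibleTransport Q U Tm Tp → (∀ L, ContinuousOn (Tm L) (Icc (-1) 1)) →
      (∃ f : ℕ → ℝ, RapidDecay f ∧ ∀ L : EvenSide, ∀ s ∈ Icc (-1 : ℝ) 1,
        ‖expVal (Ω L s) (Tm L s) - expVal (Ω L 0) (Tm L 0)‖ ≤ f L) ∧
      (∃ L₀ : ℕ, ∀ L : EvenSide, L₀ ≤ (L : ℕ) → ∃ m : ℤ, ∀ s ∈ Icc (-1 : ℝ) 1,
        ‖expVal (Ω L s) (Tm L s) - (m : ℂ)‖ < 1 / 2)) := by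
  refine ⟨exists_admissible_continuous hQ hUΩ hU, fun Tm Tp hT hTc => ?_⟩
  obtain ⟨g, hg, hgle⟩ := exists_expectation_near_int hQ hUΩ hT
  obtain ⟨C, hC⟩ := hT.norm_le
  have hg0 := hg 0
  simp only [pow_zero, one_mul] at hg0
  -- The threshold 1/4 keeps values away from half-integers, as constancy of the nearest integer
  -- requires.
  obtain ⟨L₁, hL₁⟩ := eventually_atTop.1 (hg0.eventually_lt_const (by norm_num : (0 : ℝ) < 1 / 4))
  have hre : ∀ L : EvenSide, ∀ s ∈ Icc (-1 : ℝ) 1,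
      (((expVal (Ω L s) (Tm L s)).re : ℝ) : ℂ) = expVal (Ω L s) (Tm L s) := fun L s hs =>
    ofReal_re_inner_of_isSelfAdjoint (hT.selfAdjoint L s hs).1 _
  have hcont : ∀ L : EvenSide,
      ContinuousOn (fun s => (expVal (Ω L s) (Tm L s)).re) (Icc (-1) 1) := fun L =>
    Complex.continuous_re.comp_continuousOn ((hΩ L).inner ((hTc L).clm_apply (hΩ L)))
  have hint : ∀ L : EvenSide, max 64 L₁ ≤ (L : ℕ) → ∃ m : ℤ, ∀ s ∈ Icc (-1 : ℝ) 1,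
      ‖expVal (Ω L s) (Tm L s) - (m : ℂ)‖ ≤ g L := by
    intro L hL
    have h64 := (le_max_left _ _).trans hL
    obtain ⟨m, hm⟩ := exists_int_of_continuousOn (by norm_num) (hcont L) fun s hs =>
      (hgle L h64 s hs).trans_lt (hL₁ L ((le_max_right _ _).trans hL))
    refine ⟨m, fun s hs => ?_⟩
    have h1 := hgle L h64 s hs
    rw [hm s hs] at h1
    rw [← hre L s hs, ← Complex.ofReal_intCast, ← Complex.ofReal_sub, Complex.norm_real]
    exact h1
  have h0 : (0 : ℝ) ∈ Icc (-1 : ℝ) 1 := by norm_num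
  -- For small `L` the trivial bound by twice `‖T₋‖` is used, which does not affect the decay. For
  -- large `L` both expectations are within `g L` of the same integer.
  refine ⟨⟨fun m => if m < max 64 L₁ then 2 * (C * (m : ℝ) ^ d) else 2 * g m, ?_, ?_⟩,
    max 64 L₁, fun L hL => ?_⟩
  · refine (hg.const_mul 2).congr' ?_
    filter_upwards [eventually_ge_atTop (max 64 L₁)] with m hm
    rw [if_neg hm.not_gt]
  · intro L s hs
    beta_reduce
    split_ifs with hL
    · have hb : ∀ s ∈ Icc (-1 : ℝ) 1, ‖expVal (Ω L s) (Tm L s)‖ ≤ C * (L : ℝ) ^ d := fun s hs =>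
        (norm_inner_apply_le (hUΩ.norm_state L s hs) (Tm L s)).trans (hC L s hs).1
      linarith [norm_sub_le (expVal (Ω L s) (Tm L s)) (expVal (Ω L 0) (Tm L 0)), hb s hs, hb 0 h0]
    · obtain ⟨m, hm⟩ := hint L (not_lt.1 hL)
      have h1 := norm_sub_le_norm_sub_add_norm_sub (expVal (Ω L s) (Tm L s)) (m : ℂ)
        (expVal (Ω L 0) (Tm L 0))
      rw [norm_sub_rev (m : ℂ)] at h1
      linarith [hm s hs, hm 0 h0]
  · obtain ⟨m, hm⟩ := hint L hL
    refine ⟨m, fun s hs => (hm s hs).trans_lt ?_⟩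
    linarith [hL₁ L ((le_max_right _ _).trans hL)]
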